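/- A continuum is a non-empty compact connected metrizable space, with its unique compatible uniform structure. A regular covering map $f:Y\to X$ is a covering map that is the quotient map $Y\to X=Y/G$ of a free action of a group $G$ of homeomorphisms of $Y$. For a group $G$ of bijections of a uniform space $Y$ and an entourage $E$, let $U_E(G)=\{g\in G:(y,g(y))\in E\text{ for all }y\in Y\}$ and let $N_E(G)$ be the subgroup generated by $\{g\in G:(y,g(y))\in E\text{ for some }y\in Y\}$. The group $G$ acts isomorphically if $Y$ has a basis of $G$-invariant entourages, and prodiscretely if for every entourage $E$ there is an entourage $F$ with $N_F(G)\subseteq U_E(G)$. The quotient map $Y\to X=Y/G$ (the entourages of $X$ being the images of those of $Y$) is a generalized regular covering map with deck group $G$ if $G$ acts isomorphically and prodiscretely and is complete in the uniformity of uniform convergence. Let $X$ be a continuum with basepoint $*$. Let $f_i:X_i\to X=X_i/G_i$ range over the pointed regular covering maps of $X$ by continua, with bonding maps the basepoint-preserving continuous surjections $f_{ij}:X_j\to X_i$ such that $f_j=f_i\circ f_{ij}$, and bonding homomorphisms $\theta_{ij}:G_j\to G_i$ determined by $\theta_{ij}(g)\circ f_{ij}=f_{ij}\circ g$. Let $\widehat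 X=\varprojlim X_i$ be the compact universal cover of $X$, with projection $\widehat\phi:\widehat X\to X$, and let $\pi_P(X)=\varprojlim G_i$ be the profinite fundamental group (each $G_i$ being discrete), which acts coordinatewise on $\widehat X$. For a normal subgroup $K$ of $\pi_P(X)$ the group $\pi_P(X)/K$ acts on $\widehat X/K$ by $(gK)(Kx)=K(gx)$, and the induced quotient is $$\pi:\widehat X/K\to(\widehat X/K)/(\pi_P(X)/K)=X,\qquad \pi(Kx)=\widehat\phi(x).$$ Theorem (Galois Correspondence). (1) If $Y$ is a continuum and $f:Y\to X=Y/G$ is a generalized regular covering map, then there is a closed normal subgroup $K$ of $\pi_P(X)$ such that $\widehat X/K$ is a continuum and $f$ is equivalent to the induced quotient $\pi:\widehat X/K\to(\widehat X/K)/(\pi_P(X)/K)=X$; that is, there are a uniform homeomorphism $h:Y\to\widehat X/K$ and a group isomorphism $\theta:G\to\pi_P(X)/K$ such that $h\circ g=\theta(g)\circ h$ for all $g\in G$ and $\pi\circ h=f$. (2) Conversely, for every closed normal subgroup $K$ of $\pi_P(X)$, the space $\widehat X/K$ is a continuum and the induced quotient $\pi:\widehat X/K\to X$ is a generalized regular covering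 map with deck group $\pi_P(X)/K$. -/

import Mathlib

open Topology Uniformity

universe u v w

/-- A continuum: a (non-empty) compact, connected, metrizable space. -/
class IsContinuum (X : Type*) [TopologicalSpace X] : Prop where
  compact : CompactSpace X
  connected : ConnectedSpace X
  metrizable : TopologicalSpace.MetrizableSpace X

/-- The unique uniform structure compatible with the topology of a continuum. -/
noncomputable abbrev IsContinuum.uniformSpace (X : Type*) [TopologicalSpace X]
    (h : IsContinuum X) : UniformSpace X :=
  haveI := h.compact
  haveI := h.metrizable
  uniformSpaceOfCompactR1

section UniformActions

/-- `G` acts isomorphically on the uniform space `Y`: there is a basis of `G`-invariant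
entourages. -/
def ActsIsomorphically (G : Type*) (Y : Type*) [Group G] [UniformSpace Y] [MulAction G Y] :
    Prop :=
  ∀ E ∈ 𝓤 Y, ∃ F ∈ 𝓤 Y, F ⊆ E ∧
    ∀ g : G, Prod.map (fun y : Y => g • y) (fun y : Y => g • y) '' F = F

/-- `U_E(G)`: the elements of `G` moving every point by at most `E`. -/
def uniformlySmall (G : Type*) {Y : Type*} [Group G] [MulAction G Y] (E : Set (Y × Y)) : Set G :=
  {g | ∀ y : Y, (y, g • y) ∈ E}

/-- `S_E(G)`: the elements of `G` moving some point by at most `E`. -/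
def somewhereSmall (G : Type*) {Y : Type*} [Group G] [MulAction G Y] (E : Set (Y × Y)) : Set G :=
  {g | ∃ y : Y, (y, g • y) ∈ E}

/-- `N_E(G)`: the subgroup of `G` generated by `S_E(G)`. -/
def smallSubgroup (G : Type*) {Y : Type*} [Group G] [MulAction G Y] (E : Set (Y × Y)) :
    Subgroup G :=
  Subgroup.closure (somewhereSmall G E)

/-- `G` acts prodiscretely on the uniform space `Y`. -/
def ActsProdiscretely (G : Type*) (Y : Type*) [Group G] [UniformSpace Y] [MulAction G Y] :
    Prop :=
  ∀ E ∈ 𝓤 Y, ∃ F ∈ 𝓤 Y, (smallSubgroup G F : Set G) ⊆ uniformlySmall G E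

/-- The uniformity of uniform convergence on a group `G` acting on a uniform space `Y`, whose
basic entourages are the sets `{(g, h) | ∀ y, (g • y, h • y) ∈ E}`. For an isomorphic action it is
both the left and the right uniformity of the topology on `G` that has the sets `U_E(G)` as
a basis at the identity. -/
abbrev uniformConvergenceUniformity (G : Type*) (Y : Type*) [Group G] [UniformSpace Y]
    [MulAction G Y] : UniformSpace G :=
  UniformSpace.comap (fun g : G => UniformFun.ofFun (fun y : Y => g • y)) inferInstance

/-- `f : Y → X` is the quotient map `Y → Y / G = X` of uniform spaces: it is surjective, the point
preimages are the orbits of `G`, and the entourages of `X` are the images of those of `Y`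
(so `f` is bi-uniformly continuous). -/
structure IsUniformQuotientMap (G : Type*) {Y X : Type*} [Group G] [UniformSpace Y]
    [UniformSpace X] [MulAction G Y] (f : Y → X) : Prop where
  surjective : Function.Surjective f
  apply_eq_iff : ∀ y y' : Y, f y = f y' ↔ ∃ g : G, g • y = y'
  uniformity_eq : Filter.map (Prod.map f f) (𝓤 Y) = 𝓤 X

/-- `f : Y → X = Y / G` is a generalized regular covering map with deck group `G`: `G` is
a complete group of bijections of `Y` (that is, it acts faithfully) acting isomorphically and
prodiscretely, and `f` is the quotient map. -/
structure IsGeneralizedRegularCovering (G : Type*) {Y X : Type*} [Group G] [UniformSpace Y]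
    [UniformSpace X] [MulAction G Y] (f : Y → X) : Prop where
  faithful : FaithfulSMul G Y
  isomorphic : ActsIsomorphically G Y
  prodiscrete : ActsProdiscretely G Y
  complete : @CompleteSpace G (uniformConvergenceUniformity G Y)
  quotient : IsUniformQuotientMap G f

/-- Equivalence of two quotient maps `f₁ : Y₁ → X = Y₁ / G₁` and `f₂ : Y₂ → X = Y₂ / G₂`: there
are a uniform homeomorphism `h` and a group isomorphism `θ` that are compatible with the actions,
and `h` covers the identity of the common quotient `X`. -/
def QuotientMapsEquivalent (G₁ G₂ : Type*) {Y₁ Y₂ X : Type*} [Group G₁] [Group G₂]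
    [UniformSpace Y₁] [UniformSpace Y₂] [MulAction G₁ Y₁] [MulAction G₂ Y₂]
    (f₁ : Y₁ → X) (f₂ : Y₂ → X) : Prop :=
  ∃ (h : Y₁ ≃ᵤ Y₂) (θ : G₁ ≃* G₂),
    (∀ (g : G₁) (y : Y₁), h (g • y) = θ g • h y) ∧ ∀ y : Y₁, f₂ (h y) = f₁ y

end UniformActions

section InducedAction

variable {G : Type*} {Y : Type*} [Group G] [MulAction G Y]

/-- The action of `G / K` on `Y / K` for a normal subgroup `K`: `(gK)(Ky) = K(gy)`. -/
instance inducedQuotientAction (K : Subgroup G) [K.Normal] :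
    MulAction (G ⧸ K) (MulAction.orbitRel.Quotient K Y) where
  smul := Quotient.map₂ (fun g y => g • y) (by
    intro g g' hg y y' hy
    rw [← Quotient.eq_iff_equiv, QuotientGroup.eq_iff_div_mem, div_eq_mul_inv] at hg
    obtain ⟨k, rfl⟩ := hy
    refine ⟨⟨g * g'⁻¹, hg⟩ * ⟨g' * (k : G) * g'⁻¹, ‹K.Normal›.conj_mem _ k.2 g'⟩, ?_⟩
    simp [Subgroup.smul_def, smul_smul, mul_assoc])
  one_smul := by
    rintro ⟨y⟩
    exact congrArg (Quotient.mk _) (one_smul G y)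
  mul_smul := by
    rintro ⟨g⟩ ⟨g'⟩ ⟨y⟩
    exact congrArg (Quotient.mk _) (mul_smul g g' y)

end InducedAction

/-- A (traditional) regular covering map `f : Y → X = Y / G`: a covering map that is also the
quotient map of a free action by a group `G` of homeomorphisms of `Y`. -/
structure IsRegularCovering {Y X : Type*} [TopologicalSpace Y] [TopologicalSpace X]
    (G : Subgroup (Y ≃ₜ Y)) (f : Y → X) : Prop where
  isCoveringMap : IsCoveringMap f
  isQuotientMap : IsQuotientMap f
  free : ∀ g ∈ G, ∀ y : Y, g y = y → g = 1
  apply_eq_iff : ∀ y y' : Y, f y = f y' ↔ ∃ g ∈ G, g y = y'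

/-- A pointed regular cover of `(X, x₀)` by a continuum. -/
structure ContinuumCover (X : Type u) [TopologicalSpace X] (x₀ : X) : Type (u + 1) where
  space : Type u
  [top : TopologicalSpace space]
  [continuum : IsContinuum space]
  proj : space → X
  deck : Subgroup (space ≃ₜ space)
  regular : IsRegularCovering deck proj
  base : space
  proj_base : proj base = x₀

namespace ContinuumCover

attribute [instance] ContinuumCover.top ContinuumCover.continuum

/-- `X` as a cover of itself. -/
def self (X : Type u) [TopologicalSpace X] [IsContinuum X] (x₀ : X) : ContinuumCover X x₀ where
  space := X
  proj := id
  deck := ⊥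
  regular :=
    { isCoveringMap := fun x =>
        IsEvenlyCovered.to_isEvenlyCovered_preimage (I := Unit)
          ⟨inferInstance, Set.univ, Set.mem_univ x, isOpen_univ, isOpen_univ,
            (Homeomorph.prodUnique _ Unit).symm, fun _ => rfl⟩
      isQuotientMap := IsQuotientMap.id
      free := fun g hg _ _ => by simpa using hg
      apply_eq_iff := fun y y' => by simp }
  base := x₀
  proj_base := rfl

/-- The basepoint-preserving bonding maps `p : d.space → c.space` of the inverse system of covers:
continuous surjections with `c.proj ∘ p = d.proj`. -/
structure IsBondingMap {X : Type u} [TopologicalSpace X] {x₀ : X} (c d : ContinuumCover X x₀)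
    (p : d.space → c.space) : Prop where
  continuous : Continuous p
  surjective : Function.Surjective p
  proj_comp : c.proj ∘ p = d.proj
  map_base : p d.base = c.base

end ContinuumCover

section CompactUniversalCover

variable (X : Type u) [TopologicalSpace X] (x₀ : X)

/-- The compact universal cover `X̂` of `X`: the inverse limit of all regular covers of `X` by
continua, with the inverse limit topology. -/
def CompactUniversalCover : Type (u + 1) :=
  {x : ∀ c : ContinuumCover X x₀, c.space //
    ∀ (c d : ContinuumCover X x₀) (p : d.space → c.space),
      ContinuumCover.IsBondingMap c d p → p (x d) = x c}

instance CompactUniversalCover.instTopologicalSpace :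
    TopologicalSpace (CompactUniversalCover X x₀) :=
  inferInstanceAs (TopologicalSpace {x : ∀ c : ContinuumCover X x₀, c.space //
    ∀ (c d : ContinuumCover X x₀) (p : d.space → c.space),
      ContinuumCover.IsBondingMap c d p → p (x d) = x c})

/-- The profinite fundamental group `π_P(X)`: the inverse limit of the deck groups of all regular
covers of `X` by continua. The bonding homomorphism belonging to a bonding map `p : d → c` sends
`g` in the deck group of `d` to the unique `g'` in the deck group of `c` with `g' ∘ p = p ∘ g`. -/
def profiniteFundamentalGroup : Subgroup (∀ c : ContinuumCover X x₀, c.deck) where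
  carrier := {g | ∀ (c d : ContinuumCover X x₀) (p : d.space → c.space),
    ContinuumCover.IsBondingMap c d p →
      ∀ y : d.space, (g c : c.space ≃ₜ c.space) (p y) = p ((g d : d.space ≃ₜ d.space) y)}
  one_mem' := fun c d p _ y => rfl
  mul_mem' := by
    intro a b ha hb c d p hp y
    change (a c : c.space ≃ₜ c.space) ((b c : c.space ≃ₜ c.space) (p y)) =
      p ((a d : d.space ≃ₜ d.space) ((b d : d.space ≃ₜ d.space) y))
    rw [hb c d p hp, ha c d p hp]
  inv_mem' := by
    intro a ha c d p hp y
    change (a c : c.space ≃ₜ c.space).symm (p y) = p ((a d : d.space ≃ₜ d.space).symm y)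
    rw [Homeomorph.symm_apply_eq, ha c d p hp, Homeomorph.apply_symm_apply]

/-- The inverse limit topology on `π_P(X)`, each deck group being discrete. -/
instance profiniteFundamentalGroup.instTopologicalSpace :
    TopologicalSpace (profiniteFundamentalGroup X x₀) :=
  TopologicalSpace.induced Subtype.val
    (@Pi.topologicalSpace (ContinuumCover X x₀) (fun c => c.deck) (fun _ => ⊥))

/-- The coordinatewise action of `π_P(X)` on `X̂`. -/
instance CompactUniversalCover.instMulAction :
    MulAction (profiniteFundamentalGroup X x₀) (CompactUniversalCover X x₀) where
  smul g x := ⟨fun c => (g.1 c : c.space ≃ₜ c.space) (x.1 c), fun c d p hp => by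
    rw [← g.2 c d p hp, x.2 c d p hp]⟩
  one_smul _ := rfl
  mul_smul _ _ _ := rfl

variable [IsContinuum X]

/-- The compact universal covering map `X̂ → X`, the projection to the coordinate `X` of the
inverse limit. -/
def compactUniversalCoveringMap (x : CompactUniversalCover X x₀) : X :=
  (ContinuumCover.self X x₀).proj (x.1 (ContinuumCover.self X x₀))

/-- The quotient `X̂ / K`, with the quotient topology. -/
abbrev CoverQuotient (K : Subgroup (profiniteFundamentalGroup X x₀)) : Type (u + 1) :=
  MulAction.orbitRel.Quotient K (CompactUniversalCover X x₀)

/-- The induced quotient map `X̂ / K → (X̂ / K) / (π_P(X) / K) = X̂ / π_P(X) = X`, sending `Kx` to the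
image of `x` in `X`. -/
def inducedQuotientMap (K : Subgroup (profiniteFundamentalGroup X x₀)) :
    CoverQuotient X x₀ K → X :=
  Quotient.lift (compactUniversalCoveringMap X x₀) (by
    rintro _ y ⟨k, rfl⟩
    exact ((ContinuumCover.self X x₀).regular.apply_eq_iff _ _).mpr
      ⟨_, (k.1.1 (ContinuumCover.self X x₀)).2, rfl⟩ |>.symm)

end CompactUniversalCover

/-! Both halves rest on one picture: π_P(X) is a profinite group acting continuously and freely on
the continuum X̂, and its orbits are the fibres of X̂ → X.

For (2), a closed K is compact, so X̂/K is a Hausdorff quotient of a continuum, hence a continuum,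
and π_P(X)/K is a compact nonarchimedean group acting freely on it. Such an action on a compact
Hausdorff space satisfies every clause of the definition
(`isGeneralizedRegularCovering_of_compact`).

For (1), let N be a normal subgroup of G containing S_E(G) for some entourage E. Then G/N is finite
and Y/N is Hausdorff, so Y/N → X is a regular cover and occurs, up to homeomorphism, in the system
defining X̂. The resulting projections X̂ → Y/N are compatible. Prodiscreteness makes the N-orbits
shrink to points, so the projections assemble into an equivariant surjection ρ : X̂ → Y. Freeness
turns ρ into an epimorphism π_P(X) → G, and K is its kernel (`exists_quotientMapsEquivalent`).

The system of covers is large, yet X̂ is metrizable: finite combinatorial codes show that countably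
many covers determine all coordinates. -/

/-! ### Compact uniform spaces and actions of compact groups. -/

theorem mem_nhds_of_mem_uniformity_of_eq {Z : Type*} [UniformSpace Z] {E : Set (Z × Z)}
    (hE : E ∈ 𝓤 Z) (z : Z) : E ∈ 𝓝 (z, z) :=
  mem_nhdsSet_iff_forall.mp (nhdsSet_diagonal_le_uniformity hE) (z, z) rfl

theorem mem_uniformity_of_forall_mem_nhds {Z : Type*} [UniformSpace Z] [CompactSpace Z]
    {E : Set (Z × Z)} (hE : ∀ z, E ∈ 𝓝 (z, z)) : E ∈ 𝓤 Z := by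
  rw [← nhdsSet_diagonal_eq_uniformity, mem_nhdsSet_iff_forall]
  rintro ⟨z, z'⟩ (rfl : z = z')
  exact hE z

/-- By compactness `f` is closed, hence a quotient map, and the saturation of an open set is a union
of its translates. -/
theorem isOpenMap_of_apply_eq_iff_exists_smul {Γ Z X : Type*} [Group Γ] [TopologicalSpace Z]
    [CompactSpace Z] [MulAction Γ Z] [ContinuousConstSMul Γ Z] [TopologicalSpace X] [T2Space X]
    {f : Z → X} (hf : Continuous f) (hs : Function.Surjective f)
    (hfib : ∀ y y' : Z, f y = f y' ↔ ∃ g : Γ, g • y = y') : IsOpenMap f := by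
  intro U hU
  rw [← (hf.isClosedMap.isQuotientMap hf hs).isOpen_preimage]
  have : f ⁻¹' (f '' U) = ⋃ g : Γ, (fun z => g • z) ⁻¹' U := by
    ext z
    simp only [Set.mem_preimage, Set.mem_image, Set.mem_iUnion]
    constructor
    · rintro ⟨y, hy, hyz⟩
      obtain ⟨g, rfl⟩ := (hfib z y).mp hyz.symm
      exact ⟨g, hy⟩
    · rintro ⟨g, hg⟩
      exact ⟨_, hg, ((hfib z _).mpr ⟨g, rfl⟩).symm⟩
  rw [this]
  exact isOpen_iUnion fun g => hU.preimage (continuous_const_smul g)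

theorem isUniformQuotientMap_of_compact {Γ Z X : Type*} [Group Γ] [UniformSpace Z]
    [CompactSpace Z] [MulAction Γ Z] [ContinuousConstSMul Γ Z] [UniformSpace X] [CompactSpace X]
    [T2Space X] {f : Z → X} (hf : Continuous f) (hs : Function.Surjective f)
    (hfib : ∀ y y' : Z, f y = f y' ↔ ∃ g : Γ, g • y = y') : IsUniformQuotientMap Γ f := by
  have ho := isOpenMap_of_apply_eq_iff_exists_smul hf hs hfib
  refine ⟨hs, hfib, le_antisymm (CompactSpace.uniformContinuous_of_continuous hf) ?_⟩
  intro S hS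
  refine mem_uniformity_of_forall_mem_nhds fun x => ?_
  obtain ⟨z, rfl⟩ := hs x
  have := (ho.prodMap ho).image_mem_nhds (mem_nhds_of_mem_uniformity_of_eq hS z)
  exact Filter.mem_of_superset this (Set.image_preimage_subset _ _)

section CompactGroupActions

variable {Γ Z : Type*} [Group Γ] [TopologicalSpace Γ] [UniformSpace Z]
  [CompactSpace Z] [MulAction Γ Z] [ContinuousSMul Γ Z]

/-- A continuous action of a compact group on a compact uniform space is isomorphic. -/
theorem actsIsomorphically_of_compact [CompactSpace Γ] : ActsIsomorphically Γ Z := by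
  intro E hE
  -- The largest invariant subset of `E`. Compactness of `Γ` makes it a neighbourhood of each
  -- diagonal point.
  refine ⟨{p | ∀ g : Γ, (g • p.1, g • p.2) ∈ E}, ?_, fun p hp => by simpa using hp 1, ?_⟩
  · refine mem_uniformity_of_forall_mem_nhds fun z => ?_
    have := isCompact_univ (X := Γ).eventually_forall_of_forall_eventually (x₀ := (z, z))
      (P := fun p g => (g • p.1, g • p.2) ∈ E) (by
        intro g _
        have hc : Continuous fun q : (Z × Z) × Γ => (q.2 • q.1.1, q.2 • q.1.2) := by fun_prop
        exact hc.continuousAt (mem_nhds_of_mem_uniformity_of_eq hE (g • z)))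
    filter_upwards [this] with p hp g using hp g trivial
  · intro g
    ext ⟨a, b⟩
    constructor
    · rintro ⟨⟨a, b⟩, h, ⟨⟩⟩ k
      simpa [smul_smul] using h (k * g)
    · intro h
      exact ⟨(g⁻¹ • a, g⁻¹ • b), fun k => by simpa [smul_smul] using h (k * g⁻¹), by simp⟩

theorem eventually_forall_smul_mem_entourage {E : Set (Z × Z)} (hE : E ∈ 𝓤 Z) (g : Γ) :
    ∀ᶠ h in 𝓝 g, ∀ z : Z, (g • z, h • z) ∈ E := by
  have := isCompact_univ (X := Z).eventually_forall_of_forall_eventually (x₀ := g)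
    (P := fun h z => (g • z, h • z) ∈ E) (by
      intro z _
      have hc : Continuous fun q : Γ × Z => (g • q.2, q.1 • q.2) := by fun_prop
      exact hc.continuousAt (mem_nhds_of_mem_uniformity_of_eq hE (g • z)))
  filter_upwards [this] with p hp z using hp z trivial

/-- A continuous free action of a profinite group on a compact Hausdorff space is prodiscrete. -/
theorem actsProdiscretely_of_compact [NonarchimedeanGroup Γ] [CompactSpace Γ] [T2Space Z]
    (hfree : ∀ (g : Γ) (z : Z), g • z = z → g = 1) : ActsProdiscretely Γ Z := by
  intro E hE
  obtain ⟨N, hN⟩ := NonarchimedeanGroup.is_nonarchimedean _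
    (eventually_forall_smul_mem_entourage (Γ := Γ) hE 1)
  -- The pairs `(y, g • y)` with `g ∉ N` form a compact set, which misses the diagonal because the
  -- action is free. Its complement is the required entourage.
  have hcl : IsClosed ((fun q : Γ × Z => (q.2, q.1 • q.2)) '' ((N : Set Γ)ᶜ ×ˢ Set.univ)) := by
    refine IsCompact.isClosed (IsCompact.image ?_ (by fun_prop))
    exact (N.isOpen.isClosed_compl.isCompact).prod isCompact_univ
  refine ⟨_, mem_uniformity_of_forall_mem_nhds fun z => hcl.isOpen_compl.mem_nhds ?_, ?_⟩
  · rintro ⟨⟨g, y⟩, ⟨hg, -⟩, h⟩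
    obtain ⟨rfl, h⟩ := Prod.mk.inj h
    exact hg (hfree g y h ▸ N.one_mem)
  · suffices h : smallSubgroup Γ _ ≤ N.toSubgroup from fun g hg z => by
      simpa using hN (h hg) z
    refine (Subgroup.closure_le _).mpr ?_
    rintro g ⟨z, hz⟩
    by_contra hg
    exact hz ⟨(g, z), ⟨hg, trivial⟩, rfl⟩

/-- A group with a compact topology acting continuously is complete for uniform convergence. -/
theorem completeSpace_uniformConvergenceUniformity_of_compact [CompactSpace Γ] :
    @CompleteSpace Γ (uniformConvergenceUniformity Γ Z) := by
  -- The given compact topology is finer than that of uniform convergence, so the latter is compact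
  -- too, and compact uniform spaces are complete.
  have hc : @Continuous Γ Γ _ (uniformConvergenceUniformity Γ Z).toTopologicalSpace id := by
    refine continuous_induced_rng.mpr (continuous_iff_continuousAt.mpr fun g => ?_)
    refine (UniformFun.hasBasis_nhds Z Z _).tendsto_right_iff.mpr fun E hE => ?_
    exact eventually_forall_smul_mem_entourage hE g
  have := @isCompact_range Γ Γ _ (uniformConvergenceUniformity Γ Z).toTopologicalSpace _ id hc
  rw [Set.range_id] at this
  exact @complete_of_compact Γ (uniformConvergenceUniformity Γ Z)
    (@CompactSpace.mk Γ (uniformConvergenceUniformity Γ Z).toTopologicalSpace this)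

theorem isGeneralizedRegularCovering_of_compact [NonarchimedeanGroup Γ] [CompactSpace Γ]
    [T2Space Z] [Nonempty Z] {X : Type*} [UniformSpace X] [CompactSpace X] [T2Space X]
    (hfree : ∀ (g : Γ) (z : Z), g • z = z → g = 1)
    {f : Z → X} (hf : Continuous f) (hs : Function.Surjective f)
    (hfib : ∀ y y' : Z, f y = f y' ↔ ∃ g : Γ, g • y = y') :
    IsGeneralizedRegularCovering Γ f where
  faithful := ⟨fun {g h} hgh => by
    obtain ⟨z⟩ := ‹Nonempty Z›
    have := hfree (h⁻¹ * g) z (by rw [mul_smul, hgh z, inv_smul_smul])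
    exact (inv_mul_eq_one.mp this).symm⟩
  isomorphic := actsIsomorphically_of_compact
  prodiscrete := actsProdiscretely_of_compact hfree
  complete := completeSpace_uniformConvergenceUniformity_of_compact
  quotient := isUniformQuotientMap_of_compact hf hs hfib

end CompactGroupActions

/-! ### The action of a quotient group on the quotient space. -/

section InducedAction

variable {P W : Type*} [Group P] [MulAction P W]

@[simp]
theorem inducedQuotientAction_mk_smul_mk (K : Subgroup P) [K.Normal] (g : P) (x : W) :
    (QuotientGroup.mk g : P ⧸ K) • (Quotient.mk _ x : MulAction.orbitRel.Quotient K W) =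
      Quotient.mk _ (g • x) :=
  rfl

theorem inducedQuotientAction_free (hfree : ∀ (g : P) (x : W), g • x = x → g = 1)
    (K : Subgroup P) [K.Normal] (g : P ⧸ K) (z : MulAction.orbitRel.Quotient K W)
    (h : g • z = z) : g = 1 := by
  obtain ⟨g, rfl⟩ := QuotientGroup.mk_surjective g
  obtain ⟨x, rfl⟩ := Quotient.mk_surjective z
  obtain ⟨k, hk : (k : P) • x = g • x⟩ := Quotient.exact h
  have := hfree ((k : P)⁻¹ * g) x (by
    rw [mul_smul, ← hk, inv_smul_smul])
  rw [inv_mul_eq_one] at this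
  exact (QuotientGroup.eq_one_iff g).mpr (this ▸ k.2)

theorem inducedQuotientAction_apply_eq_iff {X : Type*} {f : W → X}
    (hfib : ∀ y y' : W, f y = f y' ↔ ∃ g : P, g • y = y') (K : Subgroup P) [K.Normal]
    {F : MulAction.orbitRel.Quotient K W → X} (hF : ∀ x, F (Quotient.mk _ x) = f x)
    (z z' : MulAction.orbitRel.Quotient K W) : F z = F z' ↔ ∃ g : P ⧸ K, g • z = z' := by
  obtain ⟨x, rfl⟩ := Quotient.mk_surjective z
  obtain ⟨y, rfl⟩ := Quotient.mk_surjective z'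
  rw [hF, hF, hfib]
  constructor
  · rintro ⟨g, rfl⟩
    exact ⟨QuotientGroup.mk g, rfl⟩
  · rintro ⟨g, hg⟩
    obtain ⟨g, rfl⟩ := QuotientGroup.mk_surjective g
    obtain ⟨k, hk : (k : P) • y = g • x⟩ := Quotient.exact hg
    refine ⟨(k : P)⁻¹ * g, ?_⟩
    rw [mul_smul, ← hk, inv_smul_smul]

variable [TopologicalSpace W]

theorem Subgroup.continuousConstSMul [ContinuousConstSMul P W] (K : Subgroup P) :
    ContinuousConstSMul K W :=
  ⟨fun k => continuous_const_smul (k : P)⟩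

theorem inducedQuotientAction_continuousConstSMul [ContinuousConstSMul P W] (K : Subgroup P)
    [K.Normal] : ContinuousConstSMul (P ⧸ K) (MulAction.orbitRel.Quotient K W) := by
  have := K.continuousConstSMul (W := W)
  refine ⟨fun g => ?_⟩
  obtain ⟨g, rfl⟩ := QuotientGroup.mk_surjective g
  refine (MulAction.isOpenQuotientMap_quotientMk (Γ := K) (T := W)).continuous_comp_iff.mp ?_
  exact continuous_quotient_mk'.comp (continuous_const_smul g)

theorem inducedQuotientAction_continuousSMul [TopologicalSpace P] [IsTopologicalGroup P]
    [ContinuousSMul P W] (K : Subgroup P)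
    [K.Normal] : ContinuousSMul (P ⧸ K) (MulAction.orbitRel.Quotient K W) := by
  have := K.continuousConstSMul (W := W)
  refine ⟨?_⟩
  refine ((QuotientGroup.isOpenQuotientMap_mk (N := K)).prodMap
    (MulAction.isOpenQuotientMap_quotientMk (Γ := K) (T := W))).continuous_comp_iff.mp ?_
  exact continuous_quotient_mk'.comp continuous_smul

/-- The quotient of a compact Hausdorff space by a compact group is Hausdorff. -/
theorem t2Space_orbitRel_quotient_of_compact [TopologicalSpace P] [CompactSpace P]
    [ContinuousSMul P W] [CompactSpace W] [T2Space W] :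
    T2Space (MulAction.orbitRel.Quotient P W) := by
  refine (t2Space_iff_of_isOpenQuotientMap MulAction.isOpenQuotientMap_quotientMk).mpr ?_
  -- The orbit relation is the image of the compact space `P × W`, hence closed.
  have : {q : W × W | (Quotient.mk (MulAction.orbitRel P W) q.1) = Quotient.mk _ q.2} =
      Set.range fun q : P × W => (q.1 • q.2, q.2) := by
    ext ⟨a, b⟩
    constructor
    · intro h
      obtain ⟨g, hg⟩ := Quotient.exact h
      exact ⟨(g, b), Prod.ext hg rfl⟩
    · rintro ⟨⟨g, x⟩, h⟩
      obtain ⟨rfl, rfl⟩ := Prod.mk.inj h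
      exact Quotient.sound ⟨g, rfl⟩
  rw [this]
  exact (isCompact_range (by fun_prop)).isClosed

end InducedAction

theorem QuotientGroup.nonarchimedeanGroup {P : Type*} [Group P] [TopologicalSpace P]
    [NonarchimedeanGroup P] (K : Subgroup P) [K.Normal] : NonarchimedeanGroup (P ⧸ K) where
  is_nonarchimedean U hU := by
    have : (QuotientGroup.mk : P → P ⧸ K) ⁻¹' U ∈ 𝓝 (1 : P) :=
      (QuotientGroup.continuous_mk (N := K)).continuousAt hU
    obtain ⟨V, hV⟩ := NonarchimedeanGroup.is_nonarchimedean _ this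
    refine ⟨⟨V.toSubgroup.map (QuotientGroup.mk' K),
      (QuotientGroup.isOpenQuotientMap_mk (N := K)).isOpenMap _ V.isOpen⟩, ?_⟩
    rintro _ ⟨g, hg, rfl⟩
    exact hV hg

/-- Second countability passes along open quotient maps, and a compact Hausdorff second countable
space is metrizable. -/
theorem isContinuum_of_isQuotientMap {W Z : Type*} [TopologicalSpace W] [IsContinuum W]
    [TopologicalSpace Z] [T2Space Z] {q : W → Z} (hq : IsOpenQuotientMap q) : IsContinuum Z := by
  have := IsContinuum.compact (X := W)
  have := IsContinuum.connected (X := W)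
  have := IsContinuum.metrizable (X := W)
  let := TopologicalSpace.metrizableSpaceMetric W
  have : CompactSpace Z := ⟨by
    rw [← hq.surjective.range_eq]
    exact isCompact_range hq.continuous⟩
  have : SecondCountableTopology Z := hq.isQuotientMap.secondCountableTopology hq.isOpenMap
  exact ⟨‹_›, hq.surjective.connectedSpace hq.continuous, inferInstance⟩

/-! ### Covering maps of compact spaces. -/

/-- A surjective quotient map by a free action of a finite group on a compact Hausdorff space is a
covering map. -/
theorem isCoveringMap_of_finite_of_free {Γ Z X : Type*} [Group Γ] [Finite Γ] [TopologicalSpace Z]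
    [CompactSpace Z] [T2Space Z] [MulAction Γ Z] [ContinuousConstSMul Γ Z] [TopologicalSpace X]
    [T2Space X] (hfree : ∀ (g : Γ) (z : Z), g • z = z → g = 1)
    {f : Z → X} (hf : Continuous f) (hs : Function.Surjective f)
    (hfib : ∀ y y' : Z, f y = f y' ↔ ∃ g : Γ, g • y = y') : IsCoveringMap f := by
  have : IsCancelSMul Γ Z := isCancelSMul_iff_eq_one_of_smul_eq.mpr hfree
  refine ((hf.isClosedMap.isQuotientMap hf hs).isQuotientCoveringMap_of_properlyDiscontinuousSMul
    (G := Γ) fun {a b} => ?_).isCoveringMap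
  rw [eq_comm, hfib]
  rfl

/-- A point of a compact space with an open map to a connected space, whose fibre is finite, has a
connected clopen neighbourhood. -/
theorem exists_isClopen_isConnected_of_finite_fiber {Z X : Type*} [TopologicalSpace Z]
    [CompactSpace Z] [TopologicalSpace X] [T2Space X] [PreconnectedSpace X] {f : Z → X}
    (hf : Continuous f) (ho : IsOpenMap f) (z : Z) (hfin : (f ⁻¹' {f z}).Finite) :
    ∃ C : Set Z, IsClopen C ∧ IsConnected C ∧ z ∈ C := by
  -- A nonempty clopen set has clopen image, so it covers the connected base and meets every fibre.
  have hmeet : ∀ B : Set Z, IsClopen B → B.Nonempty → (B ∩ f ⁻¹' {f z}).Nonempty := by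
    intro B hB hne
    have : f '' B = Set.univ :=
      IsClopen.eq_univ ⟨hf.isClosedMap _ hB.1, ho _ hB.2⟩ (hne.image f)
    obtain ⟨b, hb, hbz⟩ := this ▸ Set.mem_univ (f z)
    exact ⟨b, hb, hbz⟩
  -- Choose `C` with the fewest points over `f z`. If it split, the part without `z` would contain
  -- such a point, and the part with `z` would have fewer.
  obtain ⟨C, ⟨hC, hzC⟩, hmin⟩ := exists_minimalFor_of_wellFoundedLT
    (fun C : Set Z => IsClopen C ∧ z ∈ C) (fun C => (C ∩ f ⁻¹' {f z}).ncard)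
    ⟨Set.univ, isClopen_univ, trivial⟩
  refine ⟨C, hC, ⟨⟨z, hzC⟩, ?_⟩, hzC⟩
  rw [isPreconnected_iff_subset_of_fully_disjoint_closed hC.1]
  have key : ∀ u v : Set Z, IsClosed u → IsClosed v → C ⊆ u ∪ v → Disjoint u v → z ∈ u →
      C ⊆ u := by
    intro u v hu hv hCuv huv hzu
    have hCu : C ∩ u = C \ v := by
      ext y
      constructor
      · exact fun ⟨h1, h2⟩ => ⟨h1, fun h3 => huv.le_bot ⟨h2, h3⟩⟩
      · exact fun ⟨h1, h2⟩ => ⟨h1, (hCuv h1).resolve_right h2⟩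
    have hCv : C ∩ v = C \ u := by
      ext y
      constructor
      · exact fun ⟨h1, h2⟩ => ⟨h1, fun h3 => huv.le_bot ⟨h3, h2⟩⟩
      · exact fun ⟨h1, h2⟩ => ⟨h1, (hCuv h1).resolve_left h2⟩
    have h1 : IsClopen (C ∩ u) := ⟨hC.1.inter hu, hCu ▸ hC.2.sdiff hv⟩
    have h2 : IsClopen (C ∩ v) := ⟨hC.1.inter hv, hCv ▸ hC.2.sdiff hu⟩
    by_contra hnot
    obtain ⟨y, hyC, hyu⟩ := Set.not_subset.mp hnot
    obtain ⟨b, hb, hbz⟩ := hmeet _ h2 ⟨y, hyC, (hCuv hyC).resolve_left hyu⟩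
    have hlt : ((C ∩ u) ∩ f ⁻¹' {f z}).ncard < (C ∩ f ⁻¹' {f z}).ncard := by
      refine Set.ncard_lt_ncard ⟨fun a ha => ⟨ha.1.1, ha.2⟩, fun h => ?_⟩
        (hfin.subset Set.inter_subset_right)
      exact huv.le_bot ⟨(h ⟨hb.1, hbz⟩).1.2, hb.2⟩
    exact absurd (hmin ⟨h1, hzC, hzu⟩ hlt.le) (not_le.mpr hlt)
  intro u v hu hv hCuv huv
  rcases hCuv hzC with h | h
  · exact Or.inl (key u v hu hv hCuv huv h)
  · exact Or.inr (key v u hv hu (Set.union_comm u v ▸ hCuv) huv.symm h)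

/-- A map of spaces over `X`, from a compact local homeomorphism to a connected one, is surjective. -/
theorem IsLocalHomeomorph.surjective_of_comp_eq {Z Z' X : Type*} [TopologicalSpace Z]
    [TopologicalSpace Z'] [TopologicalSpace X] [CompactSpace Z] [Nonempty Z] [T2Space Z']
    [PreconnectedSpace Z'] {f : Z → X} {f' : Z' → X} (hf : IsLocalHomeomorph f)
    (hf' : IsLocalHomeomorph f') {p : Z → Z'} (hp : Continuous p) (h : f' ∘ p = f) :
    Function.Surjective p := by
  -- A map between local homeomorphisms over `X` is itself one, so its range is open as well as
  -- compact.
  have hop : IsOpenMap p := (IsLocalHomeomorph.of_comp (g := f') (h ▸ hf) hf' hp).isOpenMap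
  rw [← Set.range_eq_univ]
  exact IsClopen.eq_univ ⟨(isCompact_range hp).isClosed, hop.isOpen_range⟩ (Set.range_nonempty p)

theorem IsCoveringMap.finite_fiber {Z X : Type*} [TopologicalSpace Z] [CompactSpace Z]
    [TopologicalSpace X] [T1Space X] {f : Z → X} (hf : IsCoveringMap f) (x : X) :
    (f ⁻¹' {x}).Finite := by
  have := (hf x).discreteTopology_fiber
  have hc : IsClosed (f ⁻¹' {x}) := isClosed_singleton.preimage hf.continuous
  exact hc.isCompact.finite (isDiscrete_iff_discreteTopology.mpr this)

namespace IsContinuum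

variable (Z : Type*) [TopologicalSpace Z] [IsContinuum Z]

theorem t2Space : T2Space Z :=
  have := metrizable (X := Z)
  inferInstance

theorem secondCountableTopology : SecondCountableTopology Z := by
  have := compact (X := Z)
  have := metrizable (X := Z)
  let := TopologicalSpace.metrizableSpaceMetric Z
  infer_instance

end IsContinuum

/-! ### Covers of `X`, deck groups and bonding maps. -/

namespace ContinuumCover

variable {X : Type u} [TopologicalSpace X] {x₀ : X}

instance (c : ContinuumCover X x₀) : CompactSpace c.space := IsContinuum.compact
instance (c : ContinuumCover X x₀) : ConnectedSpace c.space := IsContinuum.connected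
instance (c : ContinuumCover X x₀) : TopologicalSpace.MetrizableSpace c.space :=
  IsContinuum.metrizable

theorem isCoveringMap (c : ContinuumCover X x₀) : IsCoveringMap c.proj :=
  c.regular.isCoveringMap

theorem continuous_proj (c : ContinuumCover X x₀) : Continuous c.proj :=
  c.isCoveringMap.continuous

theorem proj_surjective (c : ContinuumCover X x₀) : Function.Surjective c.proj :=
  c.regular.isQuotientMap.surjective

theorem proj_deck (c : ContinuumCover X x₀) (g : c.deck) (y : c.space) :
    c.proj ((g : c.space ≃ₜ c.space) y) = c.proj y :=
  ((c.regular.apply_eq_iff _ _).mpr ⟨g, g.2, rfl⟩).symm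

theorem deck_ext (c : ContinuumCover X x₀) {g h : c.deck} (y : c.space)
    (hy : (g : c.space ≃ₜ c.space) y = (h : c.space ≃ₜ c.space) y) : g = h := by
  have := c.regular.free (h⁻¹ * g : c.deck) (h⁻¹ * g : c.deck).2 y
    ((Homeomorph.symm_apply_eq _).mpr hy)
  exact (inv_mul_eq_one.mp (Subtype.ext this)).symm

theorem eq_of_proj_comp_eq {A : Type*} [TopologicalSpace A] [PreconnectedSpace A]
    (c : ContinuumCover X x₀) {p q : A → c.space} (hp : Continuous p) (hq : Continuous q)
    (h : ∀ a, c.proj (p a) = c.proj (q a)) (a : A) (ha : p a = q a) (b : A) : p b = q b :=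
  congrFun (c.isCoveringMap.eq_of_comp_eq hp hq (funext h) a ha) b

instance [T1Space X] (c : ContinuumCover X x₀) : Finite c.deck := by
  have := (c.isCoveringMap.finite_fiber (c.proj c.base)).to_subtype
  refine Finite.of_injective
    (fun g : c.deck => (⟨(g : c.space ≃ₜ c.space) c.base, c.proj_deck g c.base⟩ :
      c.proj ⁻¹' {c.proj c.base})) fun g h hgh => c.deck_ext c.base (congrArg Subtype.val hgh)

/-- Surjectivity is automatic, since source and target are compact connected covers. -/
theorem isBondingMap_of_comp_eq {c d : ContinuumCover X x₀} {p : d.space → c.space}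
    (hp : Continuous p) (h : c.proj ∘ p = d.proj) (hb : p d.base = c.base) :
    IsBondingMap c d p :=
  ⟨hp, d.isCoveringMap.isLocalHomeomorph.surjective_of_comp_eq
    c.isCoveringMap.isLocalHomeomorph hp h, h, hb⟩

theorem IsBondingMap.unique {c d : ContinuumCover X x₀} {p q : d.space → c.space}
    (hp : IsBondingMap c d p) (hq : IsBondingMap c d q) : p = q :=
  c.isCoveringMap.eq_of_comp_eq hp.continuous hq.continuous (hp.proj_comp.trans hq.proj_comp.symm)
    d.base (hp.map_base.trans hq.map_base.symm)

theorem IsBondingMap.comp {c d e : ContinuumCover X x₀} {p : d.space → c.space}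
    {q : e.space → d.space} (hp : IsBondingMap c d p) (hq : IsBondingMap d e q) :
    IsBondingMap c e (p ∘ q) :=
  ⟨hp.continuous.comp hq.continuous, hp.surjective.comp hq.surjective, by
    rw [← Function.comp_assoc, hp.proj_comp, hq.proj_comp], by
    rw [Function.comp_apply, hq.map_base, hp.map_base]⟩

theorem isBondingMap_id (c : ContinuumCover X x₀) : IsBondingMap c c id :=
  ⟨continuous_id, Function.surjective_id, rfl, rfl⟩

theorem isBondingMap_self [IsContinuum X] (c : ContinuumCover X x₀) :
    IsBondingMap (self X x₀) c c.proj :=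
  ⟨c.continuous_proj, c.proj_surjective, rfl, c.proj_base⟩

/-- A local homeomorphism of a continuum, in any universe, whose homeomorphisms over `X` are
transitive on the fibres, is a regular cover. -/
theorem exists_homeomorph_of_isCoveringMap [T1Space X] {Z : Type v} [TopologicalSpace Z]
    [IsContinuum Z] {f : Z → X} (hf : IsCoveringMap f) (hs : Function.Surjective f)
    (htrans : ∀ a b, f a = f b → ∃ φ : Z ≃ₜ Z, (∀ z, f (φ z) = f z) ∧ φ a = b)
    (z₀ : Z) (hz₀ : f z₀ = x₀) :
    ∃ (c : ContinuumCover X x₀) (e : c.space ≃ₜ Z), (∀ s, f (e s) = c.proj s) ∧ e c.base = z₀ := by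
  have := IsContinuum.compact (X := Z)
  have := IsContinuum.connected (X := Z)
  have := IsContinuum.metrizable (X := Z)
  -- `Z` is a disjoint union of finite fibres indexed by `X : Type u`, so it has a copy in the
  -- universe demanded by `ContinuumCover`.
  have hsmall : Small.{u} Z := by
    have : ∀ x, Finite {z // f z = x} := fun x => (hf.finite_fiber x).to_subtype
    exact small_map (Equiv.sigmaFiberEquiv f).symm
  obtain ⟨S, ⟨e₀⟩⟩ := hsmall.equiv_small
  let : TopologicalSpace S := .induced e₀.symm inferInstance
  let e : S ≃ₜ Z := e₀.symm.toHomeomorphOfIsInducing ⟨rfl⟩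
  have : CompactSpace S := e.symm.compactSpace
  have : ConnectedSpace S := e.symm.surjective.connectedSpace e.symm.continuous
  have : IsContinuum S := ⟨inferInstance, inferInstance, e.isEmbedding.metrizableSpace⟩
  have hcov : IsCoveringMap (f ∘ e) := hf.comp_homeomorph e
  refine ⟨{ space := S
            proj := f ∘ e
            deck :=
              { carrier := {φ | ∀ s, f (e (φ s)) = f (e s)}
                one_mem' := fun s => rfl
                mul_mem' := fun {a b} ha hb s => (ha (b s)).trans (hb s)
                inv_mem' := fun {a} ha s => by
                  have := ha (a.symm s)
                  rw [a.apply_symm_apply] at this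
                  exact this.symm }
            regular :=
              { isCoveringMap := hcov
                isQuotientMap := hcov.isQuotientMap (hs.comp e.surjective)
                free := fun g hg y hy => ?_
                apply_eq_iff := fun y y' => ⟨fun h => ?_, ?_⟩ }
            base := e.symm z₀
            proj_base := by simp [hz₀] }, e, fun s => rfl, e.apply_symm_apply z₀⟩
  -- A homeomorphism over `X` with a fixed point agrees there with the identity, so unique lifting
  -- makes them equal.
  · exact Homeomorph.ext fun s => congrFun (hcov.eq_of_comp_eq (g₁ := g) (g₂ := id)
      g.continuous continuous_id (funext hg) y hy) s
  · obtain ⟨φ, hφ, hab⟩ := htrans _ _ h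
    refine ⟨(e.trans φ).trans e.symm, fun s => ?_, ?_⟩
    · simp [hφ]
    · simp [hab]
  · rintro ⟨g, hg, rfl⟩
    exact (hg y).symm

end ContinuumCover

/-! ### Directedness of the system of covers. -/

namespace ContinuumCover

variable {X : Type u} [TopologicalSpace X] {x₀ : X}

/-- The fibre product of two covers. -/
abbrev FiberProduct (c d : ContinuumCover X x₀) : Type u :=
  {p : c.space × d.space // c.proj p.1 = d.proj p.2}

instance (c d : ContinuumCover X x₀) : MulAction (c.deck × d.deck) (FiberProduct c d) where
  smul g p := ⟨((g.1 : c.space ≃ₜ c.space) p.1.1, (g.2 : d.space ≃ₜ d.space) p.1.2), by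
    simp only [proj_deck, p.2]⟩
  one_smul _ := rfl
  mul_smul _ _ _ := rfl

instance (c d : ContinuumCover X x₀) :
    ContinuousConstSMul (c.deck × d.deck) (FiberProduct c d) where
  continuous_const_smul g := Continuous.subtype_mk
    (((g.1 : c.space ≃ₜ c.space).continuous.comp (continuous_fst.comp continuous_subtype_val)).prodMk
      ((g.2 : d.space ≃ₜ d.space).continuous.comp (continuous_snd.comp continuous_subtype_val))) _

instance [T2Space X] (c d : ContinuumCover X x₀) : CompactSpace (FiberProduct c d) :=
  isCompact_iff_compactSpace.mp (isClosed_eq (c.continuous_proj.comp continuous_fst)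
    (d.continuous_proj.comp continuous_snd)).isCompact

/-- The covers form a directed system. -/
theorem exists_common_cover [IsContinuum X] (c d : ContinuumCover X x₀) :
    ∃ (e : ContinuumCover X x₀) (p : e.space → c.space) (q : e.space → d.space),
      IsBondingMap c e p ∧ IsBondingMap d e q := by
  have := IsContinuum.t2Space X
  have := IsContinuum.connected (X := X)
  let f : FiberProduct c d → X := fun p => c.proj p.1.1
  have hf : Continuous f := c.continuous_proj.comp (continuous_fst.comp continuous_subtype_val)
  have hs : Function.Surjective f := fun x => by
    obtain ⟨a, ha⟩ := c.proj_surjective x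
    obtain ⟨b, hb⟩ := d.proj_surjective x
    exact ⟨⟨(a, b), ha.trans hb.symm⟩, ha⟩
  have hfib : ∀ y y', f y = f y' ↔ ∃ g : c.deck × d.deck, g • y = y' := by
    intro y y'
    constructor
    · intro h
      obtain ⟨g, hg, h1⟩ := (c.regular.apply_eq_iff y.1.1 y'.1.1).mp h
      obtain ⟨k, hk, h2⟩ := (d.regular.apply_eq_iff y.1.2 y'.1.2).mp
        (y.2.symm.trans (h.trans y'.2))
      exact ⟨(⟨g, hg⟩, ⟨k, hk⟩), Subtype.ext (Prod.ext h1 h2)⟩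
    · rintro ⟨g, rfl⟩
      exact (c.proj_deck g.1 y.1.1).symm
  have hfree : ∀ (g : c.deck × d.deck) (y : FiberProduct c d), g • y = y → g = 1 := by
    intro g y h
    have h' := congrArg Subtype.val h
    exact Prod.ext (c.deck_ext y.1.1 (congrArg Prod.fst h'))
      (d.deck_ext y.1.2 (congrArg Prod.snd h'))
  have hcov : IsCoveringMap f := isCoveringMap_of_finite_of_free hfree hf hs hfib
  -- The fibre product may be disconnected; the common cover is its component through the pair of
  -- base points.
  obtain ⟨C, hC, hCc, hzC⟩ := exists_isClopen_isConnected_of_finite_fiber hf hcov.isOpenMap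
    ⟨(c.base, d.base), c.proj_base.trans d.proj_base.symm⟩ (hcov.finite_fiber _)
  have : CompactSpace C := isCompact_iff_compactSpace.mp hC.1.isCompact
  have : ConnectedSpace C := isConnected_iff_connectedSpace.mp hCc
  have : IsContinuum C := ⟨inferInstance, inferInstance,
    (IsEmbedding.subtypeVal.comp IsEmbedding.subtypeVal).metrizableSpace⟩
  have hloc : IsLocalHomeomorph fun y : C => f y :=
    hcov.isLocalHomeomorph.comp hC.2.isOpenEmbedding_subtypeVal.isLocalHomeomorph
  have hcovC : IsCoveringMap fun y : C => f y := isLocalHomeomorph_iff_isCoveringMap.mp hloc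
  have hsC : Function.Surjective fun y : C => f y := by
    rw [← Set.range_eq_univ]
    exact IsClopen.eq_univ ⟨(isCompact_range hcovC.continuous).isClosed,
      hcovC.isOpenMap.isOpen_range⟩ (Set.range_nonempty _)
  -- An element carrying one point of the connected clopen set `C` into `C` preserves `C`. Hence
  -- transitivity on fibres survives restriction to `C`.
  have hstab : ∀ (g : c.deck × d.deck) (a : FiberProduct c d), a ∈ C → g • a ∈ C →
      ∀ y, y ∈ C ↔ g • y ∈ C := by
    intro g a ha hga y
    have key : ∀ (g : c.deck × d.deck) (a : FiberProduct c d), a ∈ C → g • a ∈ C →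
        ∀ y ∈ C, g • y ∈ C := fun g a ha hga y hy =>
      hCc.isPreconnected.subset_isClopen (hC.preimage (continuous_const_smul g)) ⟨a, ha, hga⟩ hy
    refine ⟨key g a ha hga y, fun h => ?_⟩
    simpa using key g⁻¹ (g • a) hga (by simpa using ha) _ h
  obtain ⟨e, φ, hφ, hφb⟩ := exists_homeomorph_of_isCoveringMap (x₀ := x₀) hcovC hsC (by
    rintro a b (hab : f a = f b)
    obtain ⟨g, hg⟩ := (hfib _ _).mp hab
    refine ⟨(Homeomorph.smul g).subtype (hstab g a a.2 (hg ▸ b.2)), fun z => ?_, Subtype.ext hg⟩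
    exact ((hfib _ _).mpr ⟨g, rfl⟩).symm) ⟨_, hzC⟩ c.proj_base
  have hφ' : ∀ s, c.proj (φ s).1.1.1 = e.proj s := hφ
  refine ⟨e, fun s => (φ s).1.1.1, fun s => (φ s).1.1.2,
    isBondingMap_of_comp_eq (by fun_prop) (funext hφ) ?_,
    isBondingMap_of_comp_eq (by fun_prop) (funext fun s => ?_) ?_⟩
  · simp [hφb]
  · rw [Function.comp_apply, ← (φ s).1.2, hφ']
  · simp [hφb]

/-! ### Countably many codes for covers. -/

/-- A combinatorial description of a cover: finitely many basic open sets of the base, with the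
incidence relation of their lifts, and the index of a lift that contains the base point. -/
abbrev Code (X : Type u) [TopologicalSpace X] [SecondCountableTopology X] : Type u :=
  Σ M : ℕ, (Fin M → TopologicalSpace.countableBasis X) × (Fin M → Fin M → Prop) × Fin M

/-- The cover `c` is described by the given code. -/
def IsCodedBy [SecondCountableTopology X] (c : ContinuumCover X x₀) (t : Code X) : Prop :=
  ∃ W : Fin t.1 → Set c.space, (∀ i, IsOpen (W i)) ∧ (∀ z, ∃ i, z ∈ W i) ∧
    (∀ i, c.proj '' W i = t.2.1 i) ∧ (∀ i j, t.2.2.1 i j ↔ (W i ∩ W j).Nonempty) ∧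
    (∀ i j, t.2.2.1 i j → Set.InjOn c.proj (W i ∪ W j)) ∧ c.base ∈ W t.2.2.2

instance [SecondCountableTopology X] : Countable (Code X) := by
  have := (TopologicalSpace.countable_countableBasis X).to_subtype
  infer_instance

/-- Local injectivity becomes uniform by compactness: distinct points of a fibre are at least some
`ε` apart. Small balls, trimmed to lie over basic open sets, then give the code. -/
theorem exists_isCodedBy [SecondCountableTopology X] (c : ContinuumCover X x₀) :
    ∃ t : Code X, c.IsCodedBy t := by
  let := TopologicalSpace.metrizableSpaceMetric c.space
  have hE : {p : c.space × c.space | c.proj p.1 = c.proj p.2 → p.1 = p.2} ∈ 𝓤 c.space := by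
    refine mem_uniformity_of_forall_mem_nhds fun z => ?_
    obtain ⟨U, hU, hz, hinj⟩ := c.isCoveringMap.isLocalHomeomorph.isLocallyInjective z
    filter_upwards [prod_mem_nhds (hU.mem_nhds hz) (hU.mem_nhds hz)] with p hp h
    exact hinj hp.1 hp.2 h
  obtain ⟨ε, hε, hinj⟩ := Metric.mem_uniformity_dist.mp hE
  have hU : ∀ z : c.space, ∃ U ∈ TopologicalSpace.countableBasis X, c.proj z ∈ U ∧
      U ⊆ c.proj '' Metric.ball z (ε / 4) := fun z =>
    (TopologicalSpace.isBasis_countableBasis X).exists_subset_of_mem_open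
      ⟨z, Metric.mem_ball_self (by positivity), rfl⟩
      (c.isCoveringMap.isOpenMap _ Metric.isOpen_ball)
  choose U hUb hzU hUs using hU
  let V : c.space → Set c.space := fun z => Metric.ball z (ε / 4) ∩ c.proj ⁻¹' U z
  have hVo : ∀ z, IsOpen (V z) := fun z => Metric.isOpen_ball.inter
    (((TopologicalSpace.isBasis_countableBasis X).isOpen (hUb z)).preimage c.continuous_proj)
  obtain ⟨T, hT⟩ := isCompact_univ.elim_finite_subcover V hVo fun z _ =>
    Set.mem_iUnion.mpr ⟨z, Metric.mem_ball_self (by positivity), hzU z⟩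
  have hT' : ∀ z, ∃ i : Fin T.card, z ∈ V (T.equivFin.symm i) := by
    intro z
    obtain ⟨y, hy, hz⟩ := Set.mem_iUnion₂.mp (hT (Set.mem_univ z))
    exact ⟨T.equivFin ⟨y, hy⟩, by simpa using hz⟩
  obtain ⟨i₀, hi₀⟩ := hT' c.base
  refine ⟨⟨T.card, fun i => ⟨_, hUb (T.equivFin.symm i)⟩,
    fun i j => (V (T.equivFin.symm i) ∩ V (T.equivFin.symm j)).Nonempty, i₀⟩,
    fun i => V (T.equivFin.symm i), fun i => hVo _, hT', fun i => ?_, fun i j => Iff.rfl, ?_, hi₀⟩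
  · rw [Set.image_inter_preimage]
    exact Set.inter_eq_right.mpr (hUs _)
  · rintro i j ⟨w, hwi, hwj⟩
    -- Radius `ε / 4` puts every point of two overlapping pieces within `ε / 2` of a common point,
    -- so any two are less than `ε` apart.
    have hdist : ∀ a ∈ V (T.equivFin.symm i) ∪ V (T.equivFin.symm j), dist a w < ε / 2 := by
      rintro a (ha | ha)
      · linarith [dist_triangle_right a w (T.equivFin.symm i : c.space), Metric.mem_ball.mp ha.1,
          Metric.mem_ball.mp hwi.1]
      · linarith [dist_triangle_right a w (T.equivFin.symm j : c.space), Metric.mem_ball.mp ha.1,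
          Metric.mem_ball.mp hwj.1]
    intro a ha b hb hab
    exact hinj (by linarith [dist_triangle_right a b w, hdist a ha, hdist b hb]) hab

/-- Covers with the same code are related by a bonding map. -/
theorem IsCodedBy.exists_isBondingMap [SecondCountableTopology X] {c d : ContinuumCover X x₀}
    {t : Code X} (hc : c.IsCodedBy t) (hd : d.IsCodedBy t) : ∃ p, IsBondingMap c d p := by
  obtain ⟨V, hVo, -, hVp, hVr, hVi, hVb⟩ := hc
  obtain ⟨W, hWo, hWc, hWp, hWr, hWi, hWb⟩ := hd
  have hex : ∀ (z : d.space) (i : Fin t.1), z ∈ W i → ∃ y ∈ V i, c.proj y = d.proj z := by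
    intro z i hz
    have : d.proj z ∈ c.proj '' V i := by
      rw [hVp, ← hWp]
      exact ⟨z, hz, rfl⟩
    exact this
  -- A point of `W i` goes to the point of `V i` with the same projection. If it also lies in `W j`,
  -- the code says that `V i` and `V j` are incident, and injectivity on their union makes the two
  -- choices agree.
  have hex' : ∀ z : d.space, ∃ y : c.space, c.proj y = d.proj z ∧
      ∀ i, z ∈ W i → y ∈ V i := by
    intro z
    obtain ⟨i, hi⟩ := hWc z
    obtain ⟨y, hy, hyz⟩ := hex z i hi
    refine ⟨y, hyz, fun j hj => ?_⟩
    obtain ⟨y', hy', hyz'⟩ := hex z j hj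
    have := hVi i j ((hWr i j).mpr ⟨z, hi, hj⟩) (Or.inl hy) (Or.inr hy') (hyz.trans hyz'.symm)
    exact this ▸ hy'
  choose p hp hpV using hex'
  have hinj : ∀ i, (W i).Nonempty → Set.InjOn c.proj (V i) := fun i hi =>
    (hVi i i ((hWr i i).mpr (by simpa using hi))).mono (by simp)
  refine ⟨p, isBondingMap_of_comp_eq ?_ (funext hp) ?_⟩
  · refine continuous_def.mpr fun O hO => ?_
    -- On `W i` the map is `d.proj` followed by the inverse of the open injection `c.proj` on `V i`.
    have : p ⁻¹' O = ⋃ i, W i ∩ d.proj ⁻¹' (c.proj '' (O ∩ V i)) := by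
      ext z
      simp only [Set.mem_preimage, Set.mem_iUnion]
      constructor
      · intro hz
        obtain ⟨i, hi⟩ := hWc z
        exact ⟨i, hi, p z, ⟨hz, hpV z i hi⟩, hp z⟩
      · rintro ⟨i, hi, y, ⟨hyO, hyV⟩, hyz⟩
        rwa [hinj i ⟨z, hi⟩ (hpV z i hi) hyV ((hp z).trans hyz.symm)]
    rw [this]
    exact isOpen_iUnion fun i => (hWo i).inter
      ((c.isCoveringMap.isOpenMap _ (hO.inter (hVo i))).preimage d.continuous_proj)
  · refine hinj _ ⟨_, hWb⟩ (hpV _ _ hWb) hVb ?_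
    rw [hp, d.proj_base, c.proj_base]

end ContinuumCover

/-! ### The profinite fundamental group as a compact nonarchimedean group. -/

section

variable (X : Type u) [TopologicalSpace X] (x₀ : X)

namespace profiniteFundamentalGroup

instance : IsTopologicalGroup (profiniteFundamentalGroup X x₀) := by
  let (c : ContinuumCover X x₀) : TopologicalSpace c.deck := ⊥
  have (c : ContinuumCover X x₀) : DiscreteTopology c.deck := ⟨rfl⟩
  exact Subgroup.instIsTopologicalGroupSubtypeMem _

variable {X x₀}

theorem continuous_coord (c : ContinuumCover X x₀) :
    @Continuous _ c.deck _ ⊥ fun g : profiniteFundamentalGroup X x₀ => g.1 c := by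
  let (c : ContinuumCover X x₀) : TopologicalSpace c.deck := ⊥
  exact (continuous_apply c).comp continuous_subtype_val

variable (X x₀)

instance [T1Space X] : CompactSpace (profiniteFundamentalGroup X x₀) := by
  let (c : ContinuumCover X x₀) : TopologicalSpace c.deck := ⊥
  have (c : ContinuumCover X x₀) : DiscreteTopology c.deck := ⟨rfl⟩
  have hcl : IsClosed (profiniteFundamentalGroup X x₀ : Set (∀ c : ContinuumCover X x₀, c.deck)) := by
    have : (profiniteFundamentalGroup X x₀ : Set (∀ c : ContinuumCover X x₀, c.deck)) =
        ⋂ (c) (d) (p : d.space → c.space) (_ : ContinuumCover.IsBondingMap c d p) (y),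
          {g | (g c : c.space ≃ₜ c.space) (p y) = p ((g d : d.space ≃ₜ d.space) y)} := by
      ext g
      simp only [Set.mem_iInter]
      rfl
    rw [this]
    refine isClosed_iInter fun c => isClosed_iInter fun d => isClosed_iInter fun p =>
      isClosed_iInter fun _ => isClosed_iInter fun y => isClosed_eq ?_ ?_
    · exact (continuous_of_discreteTopology
        (f := fun k : c.deck => (k : c.space ≃ₜ c.space) (p y))).comp (continuous_apply c)
    · exact (continuous_of_discreteTopology
        (f := fun k : d.deck => p ((k : d.space ≃ₜ d.space) y))).comp (continuous_apply d)
  exact isCompact_iff_compactSpace.mp hcl.isCompact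

instance [T1Space X] : NonarchimedeanGroup (profiniteFundamentalGroup X x₀) where
  is_nonarchimedean U hU := by
    let (c : ContinuumCover X x₀) : TopologicalSpace c.deck := ⊥
    have (c : ContinuumCover X x₀) : DiscreteTopology c.deck := ⟨rfl⟩
    have : TotallyDisconnectedSpace (profiniteFundamentalGroup X x₀) :=
      Subtype.totallyDisconnectedSpace
    obtain ⟨V, hVU, hV, h1⟩ := mem_nhds_iff.mp hU
    obtain ⟨N, hN⟩ := ProfiniteGrp.exist_openNormalSubgroup_sub_open_nhds_of_one hV h1
    exact ⟨N.toOpenSubgroup, hN.trans hVU⟩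

end profiniteFundamentalGroup

/-! ### The compact universal cover is a continuum. -/

namespace CompactUniversalCover

variable {X x₀}

theorem continuous_coord (c : ContinuumCover X x₀) :
    Continuous fun x : CompactUniversalCover X x₀ => x.1 c :=
  (continuous_apply c).comp continuous_subtype_val

theorem isClosed_setOf_compatible : IsClosed {x : ∀ c : ContinuumCover X x₀, c.space |
    ∀ (c d : ContinuumCover X x₀) (p : d.space → c.space),
      ContinuumCover.IsBondingMap c d p → p (x d) = x c} := by
  simp only [Set.ofPred_forall]
  exact isClosed_iInter fun c => isClosed_iInter fun d => isClosed_iInter fun p =>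
    isClosed_iInter fun hp =>
      isClosed_eq (hp.continuous.comp (continuous_apply d)) (continuous_apply c)

instance : CompactSpace (CompactUniversalCover X x₀) :=
  isCompact_iff_compactSpace.mp isClosed_setOf_compatible.isCompact

instance : T2Space (CompactUniversalCover X x₀) :=
  inferInstanceAs (T2Space {x : ∀ c : ContinuumCover X x₀, c.space //
    ∀ (c d : ContinuumCover X x₀) (p : d.space → c.space),
      ContinuumCover.IsBondingMap c d p → p (x d) = x c})

instance : ContinuousSMul (profiniteFundamentalGroup X x₀) (CompactUniversalCover X x₀) where
  continuous_smul := by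
    let (c : ContinuumCover X x₀) : TopologicalSpace c.deck := ⊥
    have (c : ContinuumCover X x₀) : DiscreteTopology c.deck := ⟨rfl⟩
    refine Continuous.subtype_mk (continuous_pi fun c => ?_) _
    have h : Continuous fun q : c.deck × c.space => (q.1 : c.space ≃ₜ c.space) q.2 :=
      continuous_prod_of_discrete_left.mpr fun g => (g : c.space ≃ₜ c.space).continuous
    exact h.comp (((profiniteFundamentalGroup.continuous_coord c).comp continuous_fst).prodMk
      ((continuous_coord c).comp continuous_snd))

theorem smul_coord (g : profiniteFundamentalGroup X x₀) (x : CompactUniversalCover X x₀)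
    (c : ContinuumCover X x₀) : (g • x).1 c = (g.1 c : c.space ≃ₜ c.space) (x.1 c) :=
  rfl

theorem eq_one_of_smul_eq (g : profiniteFundamentalGroup X x₀) (x : CompactUniversalCover X x₀)
    (h : g • x = x) : g = 1 :=
  Subtype.ext (funext fun c => c.deck_ext (x.1 c) (congrFun (congrArg Subtype.val h) c))

variable [IsContinuum X]

theorem proj_coord (x : CompactUniversalCover X x₀) (c : ContinuumCover X x₀) :
    c.proj (x.1 c) = compactUniversalCoveringMap X x₀ x :=
  x.2 _ _ _ c.isBondingMap_self

theorem continuous_compactUniversalCoveringMap : Continuous (compactUniversalCoveringMap X x₀) :=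
  continuous_coord (ContinuumCover.self X x₀)

theorem compactUniversalCoveringMap_eq_iff (x y : CompactUniversalCover X x₀) :
    compactUniversalCoveringMap X x₀ x = compactUniversalCoveringMap X x₀ y ↔
      ∃ g : profiniteFundamentalGroup X x₀, g • x = y := by
  constructor
  · intro h
    have hg : ∀ c : ContinuumCover X x₀, ∃ g : c.deck, (g : c.space ≃ₜ c.space) (x.1 c) = y.1 c := by
      intro c
      obtain ⟨g, hg, hxy⟩ := (c.regular.apply_eq_iff (x.1 c) (y.1 c)).mp
        ((proj_coord x c).trans (h.trans (proj_coord y c).symm))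
      exact ⟨⟨g, hg⟩, hxy⟩
    choose g hg using hg
    refine ⟨⟨g, fun c d p hp => ?_⟩, Subtype.ext (funext hg)⟩
    -- Compatibility of the coordinatewise choices follows from unique lifting: both sides cover
    -- `d.proj` and agree at `x.1 d`.
    refine c.eq_of_proj_comp_eq ((g c : c.space ≃ₜ c.space).continuous.comp hp.continuous)
      (hp.continuous.comp (g d : d.space ≃ₜ d.space).continuous) (fun a => ?_) (x.1 d) ?_
    · have h1 := congrFun hp.proj_comp
      simp only [Function.comp_apply] at h1 ⊢
      rw [c.proj_deck, h1, h1, d.proj_deck]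
    · rw [x.2 c d p hp, hg, hg, y.2 c d p hp]
  · rintro ⟨g, rfl⟩
    exact ((ContinuumCover.self X x₀).proj_deck _ _).symm

/-- The projections of the inverse limit are surjective. -/
theorem coord_surjective (c : ContinuumCover X x₀) :
    Function.Surjective fun x : CompactUniversalCover X x₀ => x.1 c := by
  intro y
  -- For each `d` above `c`, the families with value `y` at `c` that are compatible below `d`. A
  -- point in all of these compact sets is a compatible family.
  let Z : {d : ContinuumCover X x₀ // ∃ p, ContinuumCover.IsBondingMap c d p} →
      Set (∀ c : ContinuumCover X x₀, c.space) := fun d =>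
    {x | x c = y ∧ ∀ e p, ContinuumCover.IsBondingMap e d.1 p → p (x d.1) = x e}
  have hcl : ∀ d, IsClosed (Z d) := by
    intro d
    have : Z d = {x | x c = y} ∩ ⋂ (e) (p : d.1.space → e.space)
        (_ : ContinuumCover.IsBondingMap e d.1 p), {x | p (x d.1) = x e} := by
      ext x
      simp [Z]
    rw [this]
    exact (isClosed_eq (continuous_apply c) continuous_const).inter <|
      isClosed_iInter fun e => isClosed_iInter fun p => isClosed_iInter fun hp =>
        isClosed_eq (hp.continuous.comp (continuous_apply d.1)) (continuous_apply e)
  have hne : ∀ d, (Z d).Nonempty := by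
    classical
    rintro ⟨d, q, hq⟩
    obtain ⟨y', rfl⟩ := hq.surjective y
    -- Push `y'` down to every cover below `d`. Other coordinates are unconstrained, so the base
    -- point serves; uniqueness of bonding maps makes the choice harmless.
    let x : ∀ e : ContinuumCover X x₀, e.space := fun e =>
      if h : ∃ p, ContinuumCover.IsBondingMap e d p then h.choose y' else e.base
    have hx : ∀ e p, ContinuumCover.IsBondingMap e d p → x e = p y' := by
      intro e p hp
      have h : ∃ p, ContinuumCover.IsBondingMap e d p := ⟨p, hp⟩
      simp only [x, dif_pos h]
      rw [h.choose_spec.unique hp]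
    refine ⟨x, hx c q hq, fun e p hp => ?_⟩
    rw [hx e p hp, hx d id d.isBondingMap_id, id]
  have hdir : Directed (· ⊇ ·) Z := by
    rintro ⟨d, q, hq⟩ ⟨d', q', hq'⟩
    obtain ⟨e, r, r', hr, hr'⟩ := d.exists_common_cover d'
    refine ⟨⟨e, q ∘ r, hq.comp hr⟩, ?_, ?_⟩
    · rintro x ⟨hxc, hx⟩
      refine ⟨hxc, fun k p hp => ?_⟩
      rw [← hx d r hr, ← hx k (p ∘ r) (hp.comp hr), Function.comp_apply]
    · rintro x ⟨hxc, hx⟩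
      refine ⟨hxc, fun k p hp => ?_⟩
      rw [← hx d' r' hr', ← hx k (p ∘ r') (hp.comp hr'), Function.comp_apply]
  have : Nonempty {d : ContinuumCover X x₀ // ∃ p, ContinuumCover.IsBondingMap c d p} :=
    ⟨⟨c, id, c.isBondingMap_id⟩⟩
  obtain ⟨x, hx⟩ := IsCompact.nonempty_iInter_of_directed_nonempty_isCompact_isClosed Z hdir hne
    (fun d => (hcl d).isCompact) hcl
  rw [Set.mem_iInter] at hx
  refine ⟨⟨x, fun k d p hp => ?_⟩, (hx ⟨c, id, c.isBondingMap_id⟩).1⟩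
  obtain ⟨e, r, r', hr, hr'⟩ := c.exists_common_cover d
  have := (hx ⟨e, r, hr⟩).2
  rw [← this d r' hr', ← this k (p ∘ r') (hp.comp hr'), Function.comp_apply]

theorem compactUniversalCoveringMap_surjective :
    Function.Surjective (compactUniversalCoveringMap X x₀) :=
  coord_surjective (ContinuumCover.self X x₀)

instance : Nonempty (CompactUniversalCover X x₀) :=
  ⟨(compactUniversalCoveringMap_surjective x₀).choose⟩

instance : ConnectedSpace (CompactUniversalCover X x₀) := by
  have : PreconnectedSpace (CompactUniversalCover X x₀) := by
    refine preconnectedSpace_iff_clopen.mpr fun S hS => ?_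
    by_contra! hne
    have hne' : Sᶜ.Nonempty := Set.nonempty_compl.mpr hne.2
    -- Pairs in `S ×ˢ Sᶜ` with equal coordinate `c`. They exist because the images of `S` and `Sᶜ`
    -- are closed and cover a connected space; a pair common to all `c` would be one point in both
    -- sets.
    let Z : ContinuumCover X x₀ →
        Set (CompactUniversalCover X x₀ × CompactUniversalCover X x₀) := fun c =>
      (S ×ˢ Sᶜ) ∩ {q | q.1.1 c = q.2.1 c}
    have hcl : ∀ c, IsClosed (Z c) := fun c => (hS.1.prod hS.compl.1).inter
      (isClosed_eq ((continuous_coord c).comp continuous_fst)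
        ((continuous_coord c).comp continuous_snd))
    have hZne : ∀ c, (Z c).Nonempty := by
      intro c
      have himg : ∀ T : Set (CompactUniversalCover X x₀), IsClosed T →
          IsClosed ((fun x : CompactUniversalCover X x₀ => x.1 c) '' T) :=
        fun T hT => (continuous_coord c).isClosedMap T hT
      obtain ⟨z, -, ⟨x, hx, hxz⟩, ⟨x', hx', hxz'⟩⟩ := isPreconnected_closed_iff.mp
        (isPreconnected_univ (α := c.space)) _ _ (himg S hS.1) (himg Sᶜ hS.compl.1)
        (by rw [← Set.image_union, Set.union_compl_self, Set.image_univ,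
          (coord_surjective c).range_eq]) (by simpa using hne.1) (by simpa using hne')
      exact ⟨(x, x'), ⟨hx, hx'⟩, hxz.trans hxz'.symm⟩
    have hmono : ∀ c d p, ContinuumCover.IsBondingMap c d p → Z d ⊆ Z c := by
      rintro c d p hp ⟨x, x'⟩ ⟨hq, h⟩
      refine ⟨hq, ?_⟩
      change x.1 c = x'.1 c
      rw [← x.2 c d p hp, ← x'.2 c d p hp]
      exact congrArg p h
    have hdir : Directed (· ⊇ ·) Z := by
      intro c d
      obtain ⟨e, r, r', hr, hr'⟩ := c.exists_common_cover d
      exact ⟨e, hmono _ _ _ hr, hmono _ _ _ hr'⟩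
    have : Nonempty (ContinuumCover X x₀) := ⟨ContinuumCover.self X x₀⟩
    obtain ⟨⟨x, x'⟩, hx⟩ := IsCompact.nonempty_iInter_of_directed_nonempty_isCompact_isClosed Z
      hdir hZne (fun d => (hcl d).isCompact) hcl
    rw [Set.mem_iInter] at hx
    have hxx' : x = x' := Subtype.ext (funext fun c => (hx c).2)
    obtain ⟨h1, h2⟩ := (hx (ContinuumCover.self X x₀)).1
    exact h2 (hxx' ▸ h1)
  exact ⟨inferInstance⟩

instance : IsContinuum (CompactUniversalCover X x₀) where
  compact := inferInstance
  connected := inferInstance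
  metrizable := by
    have := IsContinuum.secondCountableTopology X
    -- One cover `r t` for each realized code. Every other cover with that code receives a bonding
    -- map from `r t`, so these countably many coordinates separate points.
    let T := {t : ContinuumCover.Code X // ∃ c : ContinuumCover X x₀, c.IsCodedBy t}
    choose r hr using fun t : T => t.2
    let F : CompactUniversalCover X x₀ → ∀ t : T, (r t).space := fun x t => x.1 (r t)
    have hF : Continuous F := continuous_pi fun t => continuous_coord (r t)
    have hinj : Function.Injective F := by
      intro x x' h
      refine Subtype.ext (funext fun c => ?_)
      obtain ⟨t, ht⟩ := c.exists_isCodedBy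
      obtain ⟨p, hp⟩ := ht.exists_isBondingMap (hr ⟨t, c, ht⟩)
      rw [← x.2 _ _ p hp, ← x'.2 _ _ p hp]
      exact congrArg p (congrFun h ⟨t, c, ht⟩)
    have (t : T) : SecondCountableTopology (r t).space := IsContinuum.secondCountableTopology _
    have := (hF.isClosedEmbedding hinj).isEmbedding.secondCountableTopology
    infer_instance

end CompactUniversalCover
end

/-! ### Quotients of the compact universal cover. -/

section QuotientByClosedSubgroup

variable {X : Type u} [UniformSpace X] [IsContinuum X] {x₀ : X}

theorem isContinuum_coverQuotient {K : Subgroup (profiniteFundamentalGroup X x₀)}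
    (hK : IsClosed (K : Set (profiniteFundamentalGroup X x₀))) :
    IsContinuum (CoverQuotient X x₀ K) := by
  have := IsContinuum.t2Space X
  have : CompactSpace K := isCompact_iff_compactSpace.mp hK.isCompact
  have : ContinuousSMul K (CompactUniversalCover X x₀) :=
    ⟨(continuous_smul (M := profiniteFundamentalGroup X x₀)).comp
      ((continuous_subtype_val.comp continuous_fst).prodMk continuous_snd)⟩
  have : T2Space (CoverQuotient X x₀ K) := t2Space_orbitRel_quotient_of_compact
  exact isContinuum_of_isQuotientMap (MulAction.isOpenQuotientMap_quotientMk (Γ := K)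
    (T := CompactUniversalCover X x₀))

theorem isGeneralizedRegularCovering_inducedQuotientMap
    (K : Subgroup (profiniteFundamentalGroup X x₀)) [K.Normal]
    (hK : IsContinuum (CoverQuotient X x₀ K)) :
    letI : UniformSpace (CoverQuotient X x₀ K) := hK.uniformSpace
    IsGeneralizedRegularCovering (profiniteFundamentalGroup X x₀ ⧸ K)
      (inducedQuotientMap X x₀ K) := by
  have := IsContinuum.t2Space X
  have := IsContinuum.compact (X := X)
  have := hK.t2Space
  have := hK.compact
  have := hK.connected
  have := QuotientGroup.nonarchimedeanGroup K
  have := inducedQuotientAction_continuousSMul (W := CompactUniversalCover X x₀) K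
  let : UniformSpace (CoverQuotient X x₀ K) := hK.uniformSpace
  refine isGeneralizedRegularCovering_of_compact
    (inducedQuotientAction_free CompactUniversalCover.eq_one_of_smul_eq K) ?_ ?_
    (inducedQuotientAction_apply_eq_iff
      CompactUniversalCover.compactUniversalCoveringMap_eq_iff K fun _ => rfl)
  · exact CompactUniversalCover.continuous_compactUniversalCoveringMap.quotient_lift _
  · intro x
    obtain ⟨y, hy⟩ := CompactUniversalCover.compactUniversalCoveringMap_surjective x
    exact ⟨Quotient.mk _ y, hy⟩

end QuotientByClosedSubgroup

/-! ### Entourage subgroups and finite quotients of a deck group. -/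

section EntourageQuotients

variable {G : Type w} {Y : Type v} [Group G] [UniformSpace Y] [MulAction G Y]

theorem ActsIsomorphically.continuousConstSMul (h : ActsIsomorphically G Y) :
    ContinuousConstSMul G Y := by
  refine ⟨fun g => UniformContinuous.continuous fun E hE => ?_⟩
  obtain ⟨F, hF, hFE, hinv⟩ := h E hE
  refine Filter.mem_map.mpr (Filter.mem_of_superset hF fun p hp => hFE ?_)
  rw [← hinv g]
  exact ⟨p, hp, rfl⟩

/-- An element with a fixed point lies in N_F(G) for every F, hence by prodiscreteness in U_E(G) for
every E, so it fixes every point. -/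
theorem IsGeneralizedRegularCovering.eq_one_of_smul_eq [T0Space Y] {X : Type*} [UniformSpace X]
    {f : Y → X} (h : IsGeneralizedRegularCovering G f) (g : G) (y : Y) (hgy : g • y = y) :
    g = 1 := by
  have := h.faithful
  refine FaithfulSMul.eq_of_smul_eq_smul (α := Y) fun z => ?_
  rw [one_smul]
  refine (eq_of_uniformity fun {E} hE => ?_).symm
  obtain ⟨F, hF, hFE⟩ := h.prodiscrete E hE
  refine hFE (Subgroup.subset_closure ⟨y, ?_⟩) z
  rw [hgy]
  exact refl_mem_uniformity hF

/-- The normal subgroups that contain all elements moving some point by at most some entourage. -/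
structure IsEntourageSubgroup {G : Type*} (Y : Type*) [Group G] [UniformSpace Y] [MulAction G Y]
    (N : Subgroup G) : Prop where
  normal : N.Normal
  exists_entourage : ∃ E ∈ 𝓤 Y, somewhereSmall G E ⊆ N

theorem isEntourageSubgroup_top : IsEntourageSubgroup Y (⊤ : Subgroup G) :=
  ⟨inferInstance, Set.univ, Filter.univ_mem, fun _ _ => trivial⟩

theorem IsEntourageSubgroup.inf {M N : Subgroup G} (hM : IsEntourageSubgroup Y M)
    (hN : IsEntourageSubgroup Y N) : IsEntourageSubgroup Y (M ⊓ N) := by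
  obtain ⟨h1, E, hE, hEM⟩ := hM
  obtain ⟨h2, F, hF, hFN⟩ := hN
  exact ⟨inferInstance, E ∩ F, Filter.inter_mem hE hF,
    fun g ⟨y, hy⟩ => ⟨hEM ⟨y, hy.1⟩, hFN ⟨y, hy.2⟩⟩⟩

/-- If `n` moves `y` within `E`, then the conjugate of `n` by `g` moves `g • y` within the translate
of `E` by `g`, which is `E`. -/
theorem smallSubgroup_normal {G Y : Type*} [Group G] [MulAction G Y] {E : Set (Y × Y)}
    (hE : ∀ g : G, Prod.map (fun y : Y => g • y) (fun y : Y => g • y) '' E = E) :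
    (smallSubgroup G E).Normal := by
  refine ⟨fun n hn g => ?_⟩
  induction hn using Subgroup.closure_induction with
  | mem n hn =>
    obtain ⟨y, hy⟩ := hn
    refine Subgroup.subset_closure ⟨g • y, ?_⟩
    rw [← hE g]
    exact ⟨_, hy, by simp [mul_smul]⟩
  | one => simp
  | mul a b _ _ ha hb => simpa [mul_assoc] using mul_mem ha hb
  | inv a _ ha => simpa [mul_assoc] using inv_mem ha

theorem exists_isEntourageSubgroup_subset (hi : ActsIsomorphically G Y)
    (hp : ActsProdiscretely G Y) {E : Set (Y × Y)} (hE : E ∈ 𝓤 Y) :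
    ∃ N : Subgroup G, IsEntourageSubgroup Y N ∧ (N : Set G) ⊆ uniformlySmall G E := by
  obtain ⟨F, hF, hFE⟩ := hp E hE
  obtain ⟨F', hF', hFF', hinv⟩ := hi F hF
  refine ⟨smallSubgroup G F', ⟨smallSubgroup_normal hinv, F', hF', Subgroup.subset_closure⟩,
    Set.Subset.trans ?_ hFE⟩
  exact Subgroup.closure_mono fun g ⟨y, hy⟩ => ⟨y, hFF' hy⟩

/-- The orbits of an entourage subgroup form a Hausdorff quotient. -/
theorem IsEntourageSubgroup.t2Space {N : Subgroup G} (hN : IsEntourageSubgroup Y N)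
    [ContinuousConstSMul G Y] [T2Space Y] {X : Type*} [TopologicalSpace X] [T2Space X]
    {f : Y → X} (hf : Continuous f) (hfib : ∀ y y' : Y, f y = f y' ↔ ∃ g : G, g • y = y') :
    T2Space (MulAction.orbitRel.Quotient N Y) := by
  have := N.continuousConstSMul (W := Y)
  refine (t2Space_iff_of_isOpenQuotientMap MulAction.isOpenQuotientMap_quotientMk).mpr ?_
  obtain ⟨E, hE, hEN⟩ := hN.exists_entourage
  refine isClosed_of_closure_subset fun ⟨y, y'⟩ hy => ?_
  have hfy : f y = f y' := by
    refine closure_minimal (s := {q : Y × Y | (Quotient.mk (MulAction.orbitRel N Y) q.1) =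
      Quotient.mk _ q.2}) (t := {q : Y × Y | f q.1 = f q.2}) ?_ ?_ hy
    · rintro ⟨a, b⟩ hab
      obtain ⟨n, hn⟩ := Quotient.exact hab
      exact ((hfib b a).mpr ⟨n, hn⟩).symm
    · exact isClosed_eq (hf.comp continuous_fst) (hf.comp continuous_snd)
  obtain ⟨g, rfl⟩ := (hfib _ _).mp hfy
  -- For `(a, b)` near `(y, g • y)` in the orbit relation, with `a = n • b`, the element `g * n`
  -- moves `b` by at most `E`. So it lies in `N`, and hence so does `g`.
  have hc : Continuous fun q : Y × Y => (q.2, g • q.1) := by fun_prop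
  have hnhds : (fun q : Y × Y => (q.2, g • q.1)) ⁻¹' E ∈ 𝓝 (y, g • y) :=
    hc.continuousAt (mem_nhds_of_mem_uniformity_of_eq hE (g • y))
  obtain ⟨⟨a, b⟩, hab, hq⟩ := mem_closure_iff_nhds.mp hy _ hnhds
  obtain ⟨n, hn : (n : G) • b = a⟩ := Quotient.exact hq
  have hgn : g * n ∈ N := hEN ⟨b, by
    rw [mul_smul, hn]
    exact hab⟩
  have hg : g ∈ N := (Subgroup.mul_mem_cancel_right _ n.2).mp hgn
  exact (Quotient.sound (⟨⟨g, hg⟩, rfl⟩ : MulAction.orbitRel N Y (g • y) y)).symm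

/-- Total boundedness gives finitely many centres near the orbit of a point. If `g • y` and `h • y`
share a centre, then `h * g⁻¹` moves `g • y` by at most `E`, so `g` and `h` lie in one coset. -/
theorem IsEntourageSubgroup.finite_quotient {N : Subgroup G} (hN : IsEntourageSubgroup Y N)
    [CompactSpace Y] [Nonempty Y] : Finite (G ⧸ N) := by
  obtain ⟨E, hE, hEN⟩ := hN.exists_entourage
  have := hN.normal
  obtain ⟨V, hV, hVs, hVE⟩ := comp_symm_mem_uniformity_sets hE
  obtain ⟨T, hT, hcov⟩ := isCompact_univ (X := Y).totallyBounded V hV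
  obtain ⟨y⟩ := ‹Nonempty Y›
  have hex : ∀ g : G, ∃ t ∈ T, (g • y, t) ∈ V := fun g => by
    simpa using hcov (Set.mem_univ (g • y))
  choose t ht htV using hex
  have := hT.to_subtype
  refine Finite.of_injective (fun q : G ⧸ N => (⟨t q.out, ht q.out⟩ : T)) fun q r hqr => ?_
  rw [← QuotientGroup.out_eq' q, ← QuotientGroup.out_eq' r, eq_comm, QuotientGroup.eq_iff_div_mem]
  refine hEN ⟨q.out • y, hVE ⟨t q.out, htV _, ?_⟩⟩
  rw [div_eq_mul_inv, smul_smul, inv_mul_cancel_right]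
  exact hVs.symm _ _ (by
    rw [show t q.out = t r.out from congrArg Subtype.val hqr]
    exact htV _)

end EntourageQuotients

/-! ### Recognizing an equivariant image as a quotient. -/

theorem continuous_of_isClosed_graph {A B : Type*} [TopologicalSpace A] [TopologicalSpace B]
    [CompactSpace B] {ρ : A → B} (h : IsClosed {q : A × B | ρ q.1 = q.2}) : Continuous ρ := by
  refine continuous_iff_isClosed.mpr fun C hC => ?_
  have : ρ ⁻¹' C = Prod.fst '' ({q : A × B | ρ q.1 = q.2} ∩ Prod.snd ⁻¹' C) := by
    ext a
    constructor
    · exact fun ha => ⟨(a, ρ a), ⟨rfl, ha⟩, rfl⟩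
    · rintro ⟨⟨a, b⟩, ⟨hab, hb⟩, rfl⟩
      exact (show ρ a = b from hab) ▸ hb
  rw [this]
  exact isClosedMap_fst_of_compactSpace _ (h.inter (hC.preimage continuous_snd))

/-- A continuous surjection of free actions over the same base is, up to equivalence, the quotient
by a closed normal subgroup. -/
theorem exists_quotientMapsEquivalent {P W G Y X : Type*} [Group P] [TopologicalSpace P]
    [TopologicalSpace W] [CompactSpace W] [MulAction P W] [ContinuousSMul P W] [Nonempty W]
    [Group G] [UniformSpace Y] [CompactSpace Y] [T2Space Y] [MulAction G Y]
    (hfree : ∀ (g : G) (y : Y), g • y = y → g = 1) {φ : W → X} {f : Y → X}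
    (hφ : ∀ x x' : W, φ x = φ x' ↔ ∃ g : P, g • x = x')
    (hf : ∀ (g : G) (y : Y), f (g • y) = f y)
    {ρ : W → Y} (hρ : Continuous ρ) (hs : Function.Surjective ρ) (hρf : ∀ x, f (ρ x) = φ x)
    (heq : ∀ g : P, ∃ γ : G, ∀ x, ρ (g • x) = γ • ρ x) :
    ∃ (K : Subgroup P) (_ : K.Normal), IsClosed (K : Set P) ∧
      ∀ [U : UniformSpace (MulAction.orbitRel.Quotient K W)],
        U.toTopologicalSpace = instTopologicalSpaceQuotient →
        ∀ F : MulAction.orbitRel.Quotient K W → X, (∀ x, F (Quotient.mk _ x) = φ x) →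
          QuotientMapsEquivalent G (P ⧸ K) f F := by
  choose θ₀ hθ₀ using heq
  obtain ⟨x₁⟩ := ‹Nonempty W›
  have hcancel : ∀ (g h : G) (y : Y), g • y = h • y → g = h := fun g h y hy =>
    (inv_mul_eq_one.mp (hfree (h⁻¹ * g) y (by rw [mul_smul, hy, inv_smul_smul]))).symm
  -- Freeness makes the element `θ₀ g` unique, hence multiplicative in `g`.
  let θ : P →* G := MonoidHom.mk' θ₀ fun a b => hcancel _ _ (ρ x₁) (by
    rw [← hθ₀, mul_smul, hθ₀, hθ₀, mul_smul])
  have hθ : ∀ g x, ρ (g • x) = θ g • ρ x := hθ₀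
  have hθs : Function.Surjective θ := by
    intro γ
    obtain ⟨x', hx'⟩ := hs (γ • ρ x₁)
    obtain ⟨g, rfl⟩ := (hφ x₁ x').mp (by rw [← hρf, ← hρf, hx', hf])
    exact ⟨g, hcancel _ _ (ρ x₁) (by rw [← hθ, hx'])⟩
  -- The kernel is detected at any single point, which gives both its closedness and the injectivity
  -- of the induced map.
  have hker : ∀ g x, g ∈ θ.ker ↔ ρ (g • x) = ρ x := fun g x => by
    rw [MonoidHom.mem_ker, hθ]
    exact ⟨fun h => by rw [h, one_smul], hfree _ _⟩
  refine ⟨θ.ker, inferInstance, ?_, ?_⟩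
  · have : (θ.ker : Set P) = {g | ρ (g • x₁) = ρ x₁} := Set.ext fun g => hker g x₁
    rw [this]
    exact isClosed_eq (hρ.comp (by fun_prop)) continuous_const
  -- Any uniformity inducing the quotient topology will do: by compactness the homeomorphism is
  -- uniform in both directions.
  intro U hU F hF
  have hlift : ∀ a b : W, (MulAction.orbitRel θ.ker W) a b → ρ a = ρ b := by
    rintro a b ⟨k, rfl⟩
    exact (hker k b).mp k.2
  let H : MulAction.orbitRel.Quotient θ.ker W → Y := Quotient.lift ρ hlift
  have hHc : Continuous H := hρ.quotient_lift hlift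
  have hHb : Function.Bijective H := by
    constructor
    · rintro ⟨a⟩ ⟨b⟩ (hab : ρ a = ρ b)
      obtain ⟨g, rfl⟩ := (hφ b a).mp (by rw [← hρf, ← hρf, hab])
      exact Quotient.sound ⟨⟨g, (hker g b).mpr hab⟩, rfl⟩
    · intro y
      obtain ⟨x, hx⟩ := hs y
      exact ⟨Quotient.mk _ x, hx⟩
  let e : MulAction.orbitRel.Quotient θ.ker W ≃ₜ Y :=
    Continuous.homeoOfEquivCompactToT2 (f := Equiv.ofBijective H hHb) hHc
  have hcomp : @CompactSpace _ U.toTopologicalSpace := by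
    rw [hU]
    exact Quotient.compactSpace
  have he : @Continuous _ _ U.toTopologicalSpace _ e := by
    rw [hU]
    exact e.continuous
  have he' : @Continuous _ _ _ U.toTopologicalSpace e.symm := by
    rw [hU]
    exact e.symm.continuous
  let eu : MulAction.orbitRel.Quotient θ.ker W ≃ᵤ Y :=
    { e.toEquiv with
      uniformContinuous_toFun := CompactSpace.uniformContinuous_of_continuous he
      uniformContinuous_invFun := CompactSpace.uniformContinuous_of_continuous he' }
  have heu : ∀ x, eu (Quotient.mk _ x) = ρ x := fun x => rfl
  let ψ : P ⧸ θ.ker ≃* G := QuotientGroup.quotientKerEquivOfSurjective θ hθs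
  refine ⟨eu.symm, ψ.symm, fun g y => ?_, fun y => ?_⟩
  · obtain ⟨x, rfl⟩ := hs y
    obtain ⟨p, rfl⟩ := hθs g
    have h1 : ψ.symm (θ p) = QuotientGroup.mk p := ψ.symm_apply_eq.mpr rfl
    rw [← hθ, ← heu, ← heu, eu.symm_apply_apply, eu.symm_apply_apply, h1]
    rfl
  · obtain ⟨x, rfl⟩ := hs y
    rw [← heu, eu.symm_apply_apply, hF, heu, hρf]

/-! ### Mapping the compact universal cover onto a generalized regular cover. -/

section

variable {X : Type u} [UniformSpace X] [IsContinuum X] {G : Type w} {Y : Type v} [Group G]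
  [UniformSpace Y] [IsContinuum Y] [MulAction G Y] {f : Y → X}

/-- The quotients of a generalized regular cover by entourage subgroups are regular covers. -/
theorem IsGeneralizedRegularCovering.exists_continuumCover
    (h : IsGeneralizedRegularCovering G f) {x₀ : X} {y₀ : Y} (hy₀ : f y₀ = x₀)
    {N : Subgroup G} (hN : IsEntourageSubgroup Y N) :
    ∃ (c : ContinuumCover X x₀) (e : c.space ≃ₜ MulAction.orbitRel.Quotient N Y),
      (∀ s y, e s = Quotient.mk _ y → c.proj s = f y) ∧ e c.base = Quotient.mk _ y₀ := by
  have := IsContinuum.t2Space X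
  have := IsContinuum.t2Space Y
  have := IsContinuum.compact (X := Y)
  have := IsContinuum.connected (X := Y)
  have := h.isomorphic.continuousConstSMul
  have := hN.normal
  have := hN.finite_quotient
  have := N.continuousConstSMul (W := Y)
  have hf : Continuous f := UniformContinuous.continuous h.quotient.uniformity_eq.le
  have := hN.t2Space hf h.quotient.apply_eq_iff
  have : IsContinuum (MulAction.orbitRel.Quotient N Y) :=
    isContinuum_of_isQuotientMap MulAction.isOpenQuotientMap_quotientMk
  have hlift : ∀ a b : Y, (MulAction.orbitRel N Y) a b → f a = f b := by
    rintro a b ⟨k, rfl⟩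
    exact ((h.quotient.apply_eq_iff _ _).mpr ⟨k, rfl⟩).symm
  let F : MulAction.orbitRel.Quotient N Y → X := Quotient.lift f hlift
  have hFfib := inducedQuotientAction_apply_eq_iff h.quotient.apply_eq_iff N (F := F) fun _ => rfl
  have hFs : Function.Surjective F := fun x => by
    obtain ⟨y, hy⟩ := h.quotient.surjective x
    exact ⟨Quotient.mk _ y, hy⟩
  have := inducedQuotientAction_continuousConstSMul (W := Y) N
  have hcov : IsCoveringMap F := isCoveringMap_of_finite_of_free
    (inducedQuotientAction_free h.eq_one_of_smul_eq N) (hf.quotient_lift hlift) hFs hFfib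
  obtain ⟨c, e, he, hb⟩ := ContinuumCover.exists_homeomorph_of_isCoveringMap (x₀ := x₀) hcov hFs
    (fun a b hab => by
      obtain ⟨g, hg⟩ := (hFfib a b).mp hab
      exact ⟨Homeomorph.smul g, fun z => ((hFfib z _).mpr ⟨g, rfl⟩).symm, hg⟩)
    (Quotient.mk _ y₀) hy₀
  refine ⟨c, e, fun s y hs => ?_, hb⟩
  rw [← he, hs]
  rfl

end

theorem directed_entourageSubgroup {G : Type w} {Y : Type v} [Group G] [UniformSpace Y]
    [MulAction G Y] {A : Type*} {Z : {N : Subgroup G // IsEntourageSubgroup Y N} → Set A}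
    (hZ : ∀ M N, M.1 ≤ N.1 → Z M ⊆ Z N) : Directed (· ⊇ ·) Z := fun M N =>
  ⟨⟨M.1 ⊓ N.1, M.2.inf N.2⟩, hZ _ _ inf_le_left, hZ _ _ inf_le_right⟩

section

variable {X : Type u} [UniformSpace X] [IsContinuum X] {G : Type w} {Y : Type v} [Group G]
  [UniformSpace Y] [IsContinuum Y] [MulAction G Y] {f : Y → X}

/-- The compact universal cover maps compatibly to the quotients of a generalized regular cover by
its entourage subgroups. -/
theorem IsGeneralizedRegularCovering.exists_projections
    (h : IsGeneralizedRegularCovering G f) {x₀ : X} {y₀ : Y} (hy₀ : f y₀ = x₀) :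
    ∃ q : ∀ N : {N : Subgroup G // IsEntourageSubgroup Y N},
        CompactUniversalCover X x₀ → MulAction.orbitRel.Quotient N.1 Y,
      (∀ N, Continuous (q N)) ∧ (∀ N, Function.Surjective (q N)) ∧
      (∀ N x y, q N x = Quotient.mk _ y → f y = compactUniversalCoveringMap X x₀ x) ∧
      (∀ M N, M.1 ≤ N.1 → ∀ x y, q M x = Quotient.mk _ y → q N x = Quotient.mk _ y) ∧
      (∀ N, ∀ g : profiniteFundamentalGroup X x₀, ∃ γ : G, ∀ x y, q N x = Quotient.mk _ y →
        q N (g • x) = Quotient.mk _ (γ • y)) := by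
  have := h.isomorphic.continuousConstSMul
  choose c e hce hcb using
    fun N : {N : Subgroup G // IsEntourageSubgroup Y N} => h.exists_continuumCover hy₀ N.2
  refine ⟨fun N x => e N (x.1 (c N)),
    fun N => (e N).continuous.comp (CompactUniversalCover.continuous_coord _),
    fun N => (e N).surjective.comp (CompactUniversalCover.coord_surjective _),
    fun N x y hxy => ?_, fun M N hMN x y hxy => ?_, fun N g => ?_⟩
  · rw [← hce N _ _ hxy, CompactUniversalCover.proj_coord]
  · have hlift : ∀ a b : Y, (MulAction.orbitRel M.1 Y) a b →
        (Quotient.mk (MulAction.orbitRel N.1 Y) a) = Quotient.mk _ b := by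
      rintro a b ⟨k, rfl⟩
      exact Quotient.sound ⟨⟨k, hMN k.2⟩, rfl⟩
    let p : MulAction.orbitRel.Quotient M.1 Y → MulAction.orbitRel.Quotient N.1 Y :=
      Quotient.lift _ hlift
    have hp : Continuous p := continuous_quotient_mk'.quotient_lift hlift
    have hb : ContinuumCover.IsBondingMap (c N) (c M) ((e N).symm ∘ p ∘ e M) := by
      refine ContinuumCover.isBondingMap_of_comp_eq
        ((e N).symm.continuous.comp (hp.comp (e M).continuous)) (funext fun s => ?_) ?_
      · obtain ⟨y, hy⟩ := Quotient.mk_surjective (e M s)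
        rw [hce M s y hy.symm, Function.comp_apply]
        refine hce N _ y ?_
        simp only [Function.comp_apply, Homeomorph.apply_symm_apply, ← hy]
        rfl
      · simp only [Function.comp_apply, hcb, Homeomorph.symm_apply_eq]
        rfl
    change e N (x.1 (c N)) = _
    rw [← x.2 _ _ _ hb]
    simp only [Function.comp_apply, Homeomorph.apply_symm_apply]
    rw [show e M (x.1 (c M)) = Quotient.mk _ y from hxy]
    rfl
  · have := N.2.normal
    have := inducedQuotientAction_continuousConstSMul (W := Y) N.1
    obtain ⟨y₁, hy₁⟩ :=
      Quotient.mk_surjective (e N ((g.1 (c N) : (c N).space ≃ₜ (c N).space) (c N).base))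
    have hf₁ : f y₀ = f y₁ := by
      rw [← hce N _ _ hy₁.symm, ContinuumCover.proj_deck, hce N _ _ (hcb N)]
    obtain ⟨γ, rfl⟩ := (h.quotient.apply_eq_iff _ _).mp hf₁
    -- `γ` is chosen so that both sides agree at the base point; unique lifting extends this to the
    -- whole cover.
    have key : ∀ s, (g.1 (c N) : (c N).space ≃ₜ (c N).space) s =
        (e N).symm ((QuotientGroup.mk γ : G ⧸ N.1) • e N s) := by
      refine (c N).eq_of_proj_comp_eq (g.1 (c N) : (c N).space ≃ₜ (c N).space).continuous
        ((e N).symm.continuous.comp ((continuous_const_smul _).comp (e N).continuous))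
        (fun s => ?_) (c N).base ?_
      · obtain ⟨y, hy⟩ := Quotient.mk_surjective (e N s)
        rw [ContinuumCover.proj_deck, hce N s y hy.symm, hce N _ (γ • y)]
        · exact (h.quotient.apply_eq_iff _ _).mpr ⟨γ, rfl⟩
        · simp [← hy]
      · rw [Homeomorph.eq_symm_apply, ← hy₁, hcb]
        rfl
    refine ⟨γ, fun x y hxy => ?_⟩
    simp only [CompactUniversalCover.smul_coord, key, Homeomorph.apply_symm_apply]
    rw [show e N (x.1 (c N)) = Quotient.mk _ y from hxy]
    rfl

/-- A generalized regular cover is an equivariant image of the compact universal cover. -/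
theorem IsGeneralizedRegularCovering.exists_map_compactUniversalCover
    (h : IsGeneralizedRegularCovering G f) (x₀ : X) :
    ∃ ρ : CompactUniversalCover X x₀ → Y, Continuous ρ ∧ Function.Surjective ρ ∧
      (∀ x, f (ρ x) = compactUniversalCoveringMap X x₀ x) ∧
      ∀ g : profiniteFundamentalGroup X x₀, ∃ γ : G, ∀ x, ρ (g • x) = γ • ρ x := by
  have := IsContinuum.t2Space X
  have := IsContinuum.t2Space Y
  have := IsContinuum.compact (X := Y)
  have := h.isomorphic.continuousConstSMul
  have hf : Continuous f := UniformContinuous.continuous h.quotient.uniformity_eq.le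
  obtain ⟨y₀, hy₀⟩ := h.quotient.surjective x₀
  obtain ⟨q, hqc, hqs, hqf, hqle, hqg⟩ := h.exists_projections hy₀
  have hT2 (N : {N : Subgroup G // IsEntourageSubgroup Y N}) :
      T2Space (MulAction.orbitRel.Quotient N.1 Y) :=
    N.2.t2Space hf h.quotient.apply_eq_iff
  have : Nonempty {N : Subgroup G // IsEntourageSubgroup Y N} := ⟨⟨⊤, isEntourageSubgroup_top⟩⟩
  have hmk (N : {N : Subgroup G // IsEntourageSubgroup Y N}) :
      Continuous (Quotient.mk (MulAction.orbitRel N.1 Y)) := continuous_quotient_mk'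
  -- Prodiscreteness supplies entourage subgroups inside each U_E(G), so points sharing all orbits
  -- are arbitrarily close, hence equal.
  have huniq : ∀ y y' : Y, (∀ N : {N : Subgroup G // IsEntourageSubgroup Y N},
      Quotient.mk (MulAction.orbitRel N.1 Y) y = Quotient.mk _ y') → y = y' := by
    intro y y' hyy
    refine (eq_of_uniformity fun {E} hE => ?_).symm
    obtain ⟨N, hN, hNE⟩ := exists_isEntourageSubgroup_subset h.isomorphic h.prodiscrete hE
    obtain ⟨n, rfl⟩ := Quotient.exact (hyy ⟨N, hN⟩)
    exact hNE n.2 y'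
  -- The orbits picked out by the `q N x` are compact and directed, so they have a common point.
  have hex : ∀ x, ∃ y : Y, ∀ N, q N x = Quotient.mk _ y := by
    intro x
    have hcl : ∀ N, IsClosed {y : Y | q N x = Quotient.mk _ y} := fun N =>
      isClosed_eq continuous_const (hmk N)
    obtain ⟨y, hy⟩ := IsCompact.nonempty_iInter_of_directed_nonempty_isCompact_isClosed
      (fun N => {y : Y | q N x = Quotient.mk _ y})
      (directed_entourageSubgroup fun M N hMN y hy => hqle M N hMN x y hy)
      (fun N => by
        obtain ⟨y, hy⟩ := Quotient.mk_surjective (q N x)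
        exact ⟨y, hy.symm⟩) (fun N => (hcl N).isCompact) hcl
    exact ⟨y, Set.mem_iInter.mp hy⟩
  choose ρ hρ using hex
  have hρiff : ∀ x y, ρ x = y ↔ ∀ N, q N x = Quotient.mk _ y := fun x y =>
    ⟨fun hxy => hxy ▸ hρ x, fun hxy => huniq _ _ fun N => (hρ x N).symm.trans (hxy N)⟩
  have hρf : ∀ x, f (ρ x) = compactUniversalCoveringMap X x₀ x := fun x =>
    hqf ⟨⊤, isEntourageSubgroup_top⟩ x _ (hρ x _)
  refine ⟨ρ, continuous_of_isClosed_graph ?_, fun y => ?_, hρf, fun g => ?_⟩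
  · simp only [hρiff, Set.ofPred_forall]
    exact isClosed_iInter fun N =>
      isClosed_eq ((hqc N).comp continuous_fst) ((hmk N).comp continuous_snd)
  · have hcl : ∀ N, IsClosed {x | q N x = Quotient.mk _ y} := fun N =>
      isClosed_eq (hqc N) continuous_const
    obtain ⟨x, hx⟩ := IsCompact.nonempty_iInter_of_directed_nonempty_isCompact_isClosed
      (fun N => {x | q N x = Quotient.mk _ y})
      (directed_entourageSubgroup fun M N hMN x hx => hqle M N hMN x y hx)
      (fun N => hqs N _) (fun N => (hcl N).isCompact) hcl
    exact ⟨x, (hρiff x y).mpr (Set.mem_iInter.mp hx)⟩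
  · obtain ⟨x₁⟩ := (inferInstance : Nonempty (CompactUniversalCover X x₀))
    obtain ⟨γ, hγ⟩ := (h.quotient.apply_eq_iff (ρ x₁) (ρ (g • x₁))).mp (by
      rw [hρf, hρf]
      exact (CompactUniversalCover.compactUniversalCoveringMap_eq_iff _ _).mpr ⟨g, rfl⟩)
    -- `γ` is read off at the single point `x₁`. At level `N` the map is equivariant for some `δ`;
    -- freeness at `ρ x₁` forces `δ = n * γ` with `n ∈ N`, so `γ` works at every level and every
    -- `x`.
    refine ⟨γ, fun x => (hρiff _ _).mpr fun N => ?_⟩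
    obtain ⟨δ, hδ⟩ := hqg N g
    obtain ⟨n, hn : (n : G) • γ • ρ x₁ = δ • ρ x₁⟩ := Quotient.exact (s := MulAction.orbitRel N.1 Y)
      (a := δ • ρ x₁) (b := γ • ρ x₁)
      ((hδ x₁ _ (hρ x₁ N)).symm.trans (by rw [hγ]; exact hρ _ N))
    have hδγ : δ⁻¹ * (n * γ) = 1 := h.eq_one_of_smul_eq _ (ρ x₁) (by
      rw [mul_smul, mul_smul, hn, inv_smul_smul])
    rw [hδ x _ (hρ x N), inv_mul_eq_one.mp hδγ, mul_smul]
    exact Quotient.sound ⟨n, rfl⟩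

end

theorem theorem2 {X : Type u} [UniformSpace X] [IsContinuum X] (x₀ : X) :
    (∀ (Y : Type v) [UniformSpace Y] [IsContinuum Y] (G : Type w) [Group G] [MulAction G Y]
      (f : Y → X), IsGeneralizedRegularCovering G f →
        ∃ (K : Subgroup (profiniteFundamentalGroup X x₀)) (_ : K.Normal)
          (hK : IsContinuum (CoverQuotient X x₀ K)),
          IsClosed (K : Set (profiniteFundamentalGroup X x₀)) ∧
          letI : UniformSpace (CoverQuotient X x₀ K) := hK.uniformSpace
          QuotientMapsEquivalent G (profiniteFundamentalGroup X x₀ ⧸ K)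
            f (inducedQuotientMap X x₀ K)) ∧
    (∀ (K : Subgroup (profiniteFundamentalGroup X x₀)) [K.Normal],
      IsClosed (K : Set (profiniteFundamentalGroup X x₀)) →
        ∃ hK : IsContinuum (CoverQuotient X x₀ K),
          letI : UniformSpace (CoverQuotient X x₀ K) := hK.uniformSpace
          IsGeneralizedRegularCovering (profiniteFundamentalGroup X x₀ ⧸ K)
            (inducedQuotientMap X x₀ K)) := by
  refine ⟨?_, fun K _ hK => ⟨isContinuum_coverQuotient hK,
    isGeneralizedRegularCovering_inducedQuotientMap K _⟩⟩
  intro Y _ _ G _ _ f h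
  have := IsContinuum.t2Space Y
  have := IsContinuum.compact (X := Y)
  obtain ⟨ρ, hρ, hs, hρf, heq⟩ := h.exists_map_compactUniversalCover x₀
  obtain ⟨K, hK, hKc, hequiv⟩ := exists_quotientMapsEquivalent h.eq_one_of_smul_eq
    CompactUniversalCover.compactUniversalCoveringMap_eq_iff
    (fun g y => ((h.quotient.apply_eq_iff _ _).mpr ⟨g, rfl⟩).symm) hρ hs hρf heq
  exact ⟨K, hK, isContinuum_coverQuotient hKc, hKc,
    @hequiv (isContinuum_coverQuotient hKc).uniformSpace rfl (inducedQuotientMap X x₀ K)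
      fun _ => rfl⟩
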